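/- Let $\mathfrak{L}$ be a finite-dimensional Lie algebra over $\mathbb{C}$ with a fixed Levi decomposition $\mathfrak{L}=\mathfrak{g}\ltimes\mathfrak{r}$, where $\mathfrak{g}$ is a semisimple subalgebra and $\mathfrak{r}$ is the radical of $\mathfrak{L}$, and assume that $\mathfrak{r}$ is abelian (that is, $\mathfrak{L}$ is a generalized Takiff Lie algebra). Write $U(\cdot)$ for universal enveloping algebras, $Z(\mathfrak{L})$ for the center of $U(\mathfrak{L})$ and $\overline{Z(\mathfrak{L})}:=Z(\mathfrak{L})\cap U(\mathfrak{r})$. A $\mathfrak{g}$-Harish-Chandra module is an $\mathfrak{L}$-module whose restriction to $\mathfrak{g}$ is a direct sum of simple finite-dimensional $\mathfrak{g}$-modules in which every isomorphism class occurs with finite multiplicity; its $\mathfrak{g}$-types are its simple $\mathfrak{g}$-submodules. A radical central character is an algebra homomorphism $\chi\colon\overline{Z(\mathfrak{L})}\to\mathbb{C}$; an $\mathfrak{L}$-module has radical central character $\chi$ if every $z\in\overline{Z(\mathfrak{L})}$ acts on it by the scalar $\chi(z)$. Let $Q(0)=U(\mathfrak{L})\otimes_{U(\mathfrak{g})}\mathbb{C}$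 be the module induced from the trivial $\mathfrak{g}$-module, let $Q(0,\chi)=Q(0)/(\operatorname{Ker}\chi)\,Q(0)$, and let $V(0,\chi)$ be the unique simple quotient of $Q(0,\chi)$. For a simple finite-dimensional $\mathfrak{g}$-module $M$ let $[V:M]=\dim\operatorname{Hom}_{\mathfrak{g}}(M,V)$ denote the multiplicity of $M$ in a $\mathfrak{g}$-module $V$ that is a direct sum of simple finite-dimensional modules. Let $\chi$ be a radical central character and let $L$ be a simple finite-dimensional $\mathfrak{g}$-module. Then there exists a simple $\mathfrak{g}$-Harish-Chandra module for $\mathfrak{L}$ with radical central character $\chi$ having $L$ as one of its $\mathfrak{g}$-types. Moreover, the number of isomorphism classes of simple $\mathfrak{g}$-Harish-Chandra modules with radical central character $\chi$ having $L$ as one of their $\mathfrak{g}$-types is at most $$\sum_{M} l_{M,L}^{L}\,[V(0,\chi):M]<\infty,$$ where $M$ runs through the isomorphism classes of simple finite-dimensional $\mathfrak{g}$-modules and $l_{M,L}^{L}=[M\otimes L:L]$ is the multiplicity of $L$ in $M\otimes L$. -/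

import Mathlib

open scoped TensorProduct

universe u

namespace GenTakiff

section Modules

/-- A module over a complex Lie algebra `A`, bundled with its structure. -/
structure LieMod (A : Type u) [LieRing A] [LieAlgebra ℂ A] where
  /-- the underlying type -/
  carrier : Type u
  [addCommGroup : AddCommGroup carrier]
  [module : Module ℂ carrier]
  [lieRingModule : LieRingModule A carrier]
  [lieModule : LieModule ℂ A carrier]

variable {A : Type u} [LieRing A] [LieAlgebra ℂ A]

instance : CoeSort (LieMod A) (Type u) := ⟨LieMod.carrier⟩

instance (V : LieMod A) : AddCommGroup V := V.addCommGroup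
instance (V : LieMod A) : Module ℂ V := V.module
instance (V : LieMod A) : LieRingModule A V := V.lieRingModule
instance (V : LieMod A) : LieModule ℂ A V := V.lieModule

/-- Isomorphism of `A`-modules as an equivalence relation. -/
instance LieMod.isoSetoid (A : Type u) [LieRing A] [LieAlgebra ℂ A] : Setoid (LieMod A) where
  r V W := Nonempty (V ≃ₗ⁅ℂ, A⁆ W)
  iseqv :=
    ⟨fun _ => ⟨LieModuleEquiv.refl⟩, fun ⟨e⟩ => ⟨e.symm⟩, fun ⟨e⟩ ⟨f⟩ => ⟨e.trans f⟩⟩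

/-- The set of isomorphism classes of the `A`-modules that have the property `P`. -/
def isoClasses (P : LieMod A → Prop) : Set (Quotient (LieMod.isoSetoid A)) :=
  (fun V : LieMod A => Quotient.mk (LieMod.isoSetoid A) V) '' {V | P V}

/-- The multiplicity `[V : M] = dim Hom_A(M, V)` of a simple finite-dimensional module `M` in a
semisimple module `V`, as an element of `ℕ∞`. -/
noncomputable def mult (A : Type u) [LieRing A] [LieAlgebra ℂ A]
    (V : Type u) [AddCommGroup V] [Module ℂ V] [LieRingModule A V] [LieModule ℂ A V]
    (M : Type u) [AddCommGroup M] [Module ℂ M] [LieRingModule A M] [LieModule ℂ A M] : ℕ∞ :=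
  Cardinal.toENat (Module.rank ℂ (M →ₗ⁅ℂ, A⁆ V))

/-- Simple finite-dimensional modules. -/
def IsSimpleFinDim (M : LieMod A) : Prop :=
  LieModule.IsIrreducible ℂ A M ∧ FiniteDimensional ℂ M

end Modules

section HarishChandra

variable {𝔏 : Type u} [LieRing 𝔏] [LieAlgebra ℂ 𝔏]

/-- `𝔏 = g ⋉ r` is a Levi decomposition, `r` being the (solvable) radical of `𝔏`. -/
structure IsLevi (g : LieSubalgebra ℂ 𝔏) : Prop where
  semisimple : LieAlgebra.IsSemisimple ℂ g
  isCompl : IsCompl g.toSubmodule (LieAlgebra.radical ℂ 𝔏).toSubmodule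

/-- The `𝔏`-module `V` is a `g`-Harish-Chandra module: as a `g`-module it is a direct sum of simple
finite-dimensional submodules, among which every isomorphism class occurs finitely often. -/
def IsHarishChandra (g : LieSubalgebra ℂ 𝔏)
    (V : Type u) [AddCommGroup V] [Module ℂ V] [LieRingModule 𝔏 V] [LieModule ℂ 𝔏 V] : Prop :=
  ∃ (ι : Type u) (_ : DecidableEq ι) (S : ι → LieSubmodule ℂ g V),
    (∀ i, LieModule.IsIrreducible ℂ g (S i) ∧ FiniteDimensional ℂ (S i)) ∧
    DirectSum.IsInternal (fun i => (S i).toSubmodule) ∧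
    ∀ i, {j | Nonempty (S j ≃ₗ⁅ℂ, g⁆ S i)}.Finite

/-- The simple `g`-module `L` is (isomorphic to) a `g`-type of the `𝔏`-module `V`. -/
def HasType (g : LieSubalgebra ℂ 𝔏)
    (V : Type u) [AddCommGroup V] [Module ℂ V] [LieRingModule 𝔏 V] [LieModule ℂ 𝔏 V]
    (L : Type u) [AddCommGroup L] [Module ℂ L] [LieRingModule g L] [LieModule ℂ g L] : Prop :=
  ∃ S : LieSubmodule ℂ g V, Nonempty (S ≃ₗ⁅ℂ, g⁆ L)

end HarishChandra

section Center

variable (𝔏 : Type u) [LieRing 𝔏] [LieAlgebra ℂ 𝔏]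

/-- The universal enveloping algebra `U(𝔏)`. -/
abbrev Env : Type u := UniversalEnvelopingAlgebra ℂ 𝔏

/-- The purely radical part `Z(𝔏) ∩ U(r)` of the center of `U(𝔏)`; here `U(r)` is the subalgebra
of `U(𝔏)` generated by the radical `r`. -/
noncomputable def radicalCenter : Subalgebra ℂ (Env 𝔏) :=
  Subalgebra.center ℂ (Env 𝔏) ⊓
    Algebra.adjoin ℂ (UniversalEnvelopingAlgebra.ι ℂ '' (LieAlgebra.radical ℂ 𝔏 : Set 𝔏))

variable {𝔏}

/-- The purely radical part of the center acts on the `𝔏`-module `V` through `χ`. -/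
def HasRadicalCharacter (χ : radicalCenter 𝔏 →ₐ[ℂ] ℂ)
    (V : Type u) [AddCommGroup V] [Module ℂ V] [LieRingModule 𝔏 V] [LieModule ℂ 𝔏 V] : Prop :=
  ∀ (z : radicalCenter 𝔏) (v : V),
    UniversalEnvelopingAlgebra.lift ℂ (LieModule.toEnd ℂ 𝔏 V) (z : Env 𝔏) v = χ z • v

end Center

section Universal

variable {𝔏 : Type u} [LieRing 𝔏] [LieAlgebra ℂ 𝔏]

/-- The left ideal `U(𝔏) g` of `U(𝔏)`. -/
noncomputable def leftIdeal (g : LieSubalgebra ℂ 𝔏) : Submodule (Env 𝔏) (Env 𝔏) :=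
  Submodule.span (Env 𝔏) (UniversalEnvelopingAlgebra.ι ℂ '' (g : Set 𝔏))

/-- The universal module `Q(0) = U(𝔏) ⊗_{U(g)} L(0) = U(𝔏) / U(𝔏) g`, induced from the trivial
`g`-module `L(0) = U(g) / U(g) g`. -/
abbrev Q₀ (g : LieSubalgebra ℂ 𝔏) : Type u := Env 𝔏 ⧸ leftIdeal g

/-- The submodule `𝐦_χ Q(0)` of `Q(0)`, where `𝐦_χ = Ker χ`. -/
noncomputable def charSubmodule (g : LieSubalgebra ℂ 𝔏) (χ : radicalCenter 𝔏 →ₐ[ℂ] ℂ) :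
    Submodule (Env 𝔏) (Q₀ g) :=
  Submodule.span (Env 𝔏) {q | ∃ z : radicalCenter 𝔏, χ z = 0 ∧ ∃ p : Q₀ g, q = (z : Env 𝔏) • p}

/-- The universal module `Q(0, χ) = Q(0) / 𝐦_χ Q(0)`. -/
abbrev Q₀χ (g : LieSubalgebra ℂ 𝔏) (χ : radicalCenter 𝔏 →ₐ[ℂ] ℂ) : Type u :=
  Q₀ g ⧸ charSubmodule g χ

/-- The sum of all proper submodules of `Q(0, χ)`; it is the unique maximal submodule. -/
noncomputable def maxSubmodule (g : LieSubalgebra ℂ 𝔏) (χ : radicalCenter 𝔏 →ₐ[ℂ] ℂ) :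
    Submodule (Env 𝔏) (Q₀χ g χ) :=
  sSup {N | N ≠ ⊤}

/-- The underlying space of `V(0, χ)`, the unique simple quotient of `Q(0, χ)`. -/
abbrev V₀ (g : LieSubalgebra ℂ 𝔏) (χ : radicalCenter 𝔏 →ₐ[ℂ] ℂ) : Type u :=
  Q₀χ g χ ⧸ maxSubmodule g χ

/-- A `U(𝔏)`-module is an `𝔏`-module. -/
noncomputable instance (g : LieSubalgebra ℂ 𝔏) (χ : radicalCenter 𝔏 →ₐ[ℂ] ℂ) :
    LieRingModule 𝔏 (V₀ g χ) where
  bracket x v := (UniversalEnvelopingAlgebra.ι ℂ x : Env 𝔏) • v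
  add_lie x y v := by
    rw [map_add, add_smul]
  lie_add x v w := smul_add (UniversalEnvelopingAlgebra.ι ℂ x : Env 𝔏) v w
  leibniz_lie x y v := by
    change (UniversalEnvelopingAlgebra.ι ℂ x : Env 𝔏) • (UniversalEnvelopingAlgebra.ι ℂ y : Env 𝔏) • v
      = (UniversalEnvelopingAlgebra.ι ℂ ⁅x, y⁆ : Env 𝔏) • v
        + (UniversalEnvelopingAlgebra.ι ℂ y : Env 𝔏) • (UniversalEnvelopingAlgebra.ι ℂ x : Env 𝔏) • v
    let _ : LieRing (Env 𝔏) := LieRing.ofAssociativeRing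
    rw [LieHom.map_lie, LieRing.of_associative_ring_bracket, sub_smul, mul_smul, mul_smul,
      sub_add_cancel]

instance (g : LieSubalgebra ℂ 𝔏) (χ : radicalCenter 𝔏 →ₐ[ℂ] ℂ) : LieModule ℂ 𝔏 (V₀ g χ) where
  smul_lie c x v := by
    change (UniversalEnvelopingAlgebra.ι ℂ (c • x) : Env 𝔏) • v
      = c • (UniversalEnvelopingAlgebra.ι ℂ x : Env 𝔏) • v
    rw [map_smul, smul_assoc]
  lie_smul c x v := by
    change (UniversalEnvelopingAlgebra.ι ℂ x : Env 𝔏) • (c • v)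
      = c • (UniversalEnvelopingAlgebra.ι ℂ x : Env 𝔏) • v
    rw [← algebraMap_smul (Env 𝔏) c v, ← mul_smul, ← Algebra.commutes, mul_smul, algebraMap_smul]

/-- The expression `∑_M l_{M,L}^L [V(0, χ) : M]`, where `M` runs through the isomorphism classes of
simple finite-dimensional `g`-modules and `l_{M,L}^L` is the multiplicity of `L` in `M ⊗ L`. -/
noncomputable def bound (g : LieSubalgebra ℂ 𝔏) (χ : radicalCenter 𝔏 →ₐ[ℂ] ℂ)
    (L : Type u) [AddCommGroup L] [Module ℂ L] [LieRingModule g L] [LieModule ℂ g L] : ℕ∞ :=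
  ∑' M : isoClasses (A := g) IsSimpleFinDim,
    mult g (M.1.out ⊗[ℂ] L) L * mult g (V₀ g χ) M.1.out

/-- Simple `g`-Harish-Chandra modules with radical central character `χ` that have `L` as a
`g`-type. -/
def IsSimpleHC (g : LieSubalgebra ℂ 𝔏) (χ : radicalCenter 𝔏 →ₐ[ℂ] ℂ)
    (L : Type u) [AddCommGroup L] [Module ℂ L] [LieRingModule g L] [LieModule ℂ g L]
    (V : LieMod 𝔏) : Prop :=
  LieModule.IsIrreducible ℂ 𝔏 V ∧ IsHarishChandra g V ∧ HasRadicalCharacter χ V ∧ HasType g V L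

end Universal

end GenTakiff

/-!
Write `r` for the abelian radical. Inflate `L` along the projection of `𝔏 = g ⋉ r` onto `g`. A
`g`-embedding of `L` into a simple module `V` with radical character `χ` is a `g`-invariant vector
of `Hom(L, V)`. The annihilator of this vector contains the maximal submodule defining `V(0, χ)`, so
that the embedding extends to a nonzero map from `V(0, χ) ⊗ L` to `V`: the simple modules to be
counted are the simple quotients of `V(0, χ) ⊗ L` with `g`-type `L`.

Pairwise non-isomorphic simple quotients are jointly surjective, hence there are at most
`dim Hom_g(L, V(0, χ) ⊗ L)` of them, and decomposing `L ⊗ L*` into simple modules bounds this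
dimension by the sum of the theorem. Since `U(r)` is a commutative Noetherian ring over which
`V(0, χ) ⊗ L` is finitely generated, maximal submodules exist, and Hilbert's argument with the
Reynolds operator shows that all multiplicities are finite.
-/

namespace GenTakiff

section Weyl

open LieModule
open LinearMap (BilinForm trace)

theorem lie_top_top_eq_top_of_isSemisimple (R L : Type*) [CommRing R] [LieRing L] [LieAlgebra R L]
    [LieAlgebra.IsSemisimple R L] : ⁅(⊤ : LieIdeal R L), (⊤ : LieIdeal R L)⁆ = ⊤ := by
  obtain ⟨E, hE⟩ := exists_isCompl ⁅(⊤ : LieIdeal R L), (⊤ : LieIdeal R L)⁆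
  have hlie : ⁅(⊤ : LieIdeal R L), E⁆ = ⊥ :=
    eq_bot_iff.mpr <| (le_inf (LieSubmodule.mono_lie_right _ le_top)
      (LieSubmodule.lie_le_right _ _)).trans hE.inf_eq_bot.le
  have hcenter : E ≤ LieAlgebra.center R L := fun x hx y =>
    (LieSubmodule.lie_eq_bot_iff _ _).mp hlie y (LieSubmodule.mem_top y) x hx
  rw [LieAlgebra.center_eq_bot, le_bot_iff] at hcenter
  simpa [hcenter] using hE.sup_eq_top

/-- The submodule `g W` spanned by all brackets `⁅x, w⁆`; it is complementary to the invariants of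
`W` when `g` is semisimple and `W` is finite-dimensional. -/
abbrev lieRange (R L M : Type*) [CommRing R] [LieRing L] [LieAlgebra R L] [AddCommGroup M]
    [Module R M] [LieRingModule L M] : LieSubmodule R L M :=
  ⁅(⊤ : LieIdeal R L), (⊤ : LieSubmodule R L M)⁆

theorem lie_mem_lieRange {R L M : Type*} [CommRing R] [LieRing L] [LieAlgebra R L] [AddCommGroup M]
    [Module R M] [LieRingModule L M] (x : L) (m : M) : ⁅x, m⁆ ∈ lieRange R L M :=
  LieSubmodule.lie_mem_lie (LieSubmodule.mem_top _) (LieSubmodule.mem_top _)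

section CommRing

variable {R L M M' : Type*} [CommRing R] [LieRing L] [LieAlgebra R L]
  [AddCommGroup M] [Module R M] [LieRingModule L M] [LieModule R L M]
  [AddCommGroup M'] [Module R M'] [LieRingModule L M'] [LieModule R L M']

theorem map_mem_maxTrivSubmodule (f : M →ₗ⁅R,L⁆ M') {m : M} (hm : m ∈ maxTrivSubmodule R L M) :
    f m ∈ maxTrivSubmodule R L M' := fun x => by
  rw [← f.map_lie, (mem_maxTrivSubmodule R L M m).mp hm, map_zero]

theorem map_mem_lieRange (f : M →ₗ⁅R,L⁆ M') {m : M} (hm : m ∈ lieRange R L M) :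
    f m ∈ lieRange R L M' := by
  have hle : (lieRange R L M).map f ≤ lieRange R L M' := by
    rw [LieSubmodule.map_bracket_eq]
    exact LieSubmodule.mono_lie_right _ le_top
  exact hle (LieSubmodule.mem_map_of_mem hm)

theorem map_incl_maxTrivSubmodule (N : LieSubmodule R L M) :
    (maxTrivSubmodule R L N).map N.incl = maxTrivSubmodule R L M ⊓ N := by
  ext m
  constructor
  · rintro ⟨n, hn, rfl⟩
    exact ⟨map_mem_maxTrivSubmodule N.incl hn, n.2⟩
  · rintro ⟨hm, hmN⟩
    exact ⟨⟨m, hmN⟩, fun x => Subtype.ext (hm x), rfl⟩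

theorem lieRange_le_lie_lieRange [LieAlgebra.IsSemisimple R L] :
    lieRange R L M ≤ ⁅(⊤ : LieIdeal R L), lieRange R L M⁆ := by
  rw [LieSubmodule.lie_le_iff]
  intro x _ m _
  have hx : x ∈ (⁅(⊤ : LieIdeal R L), (⊤ : LieIdeal R L)⁆ : LieIdeal R L).toSubmodule :=
    (lie_top_top_eq_top_of_isSemisimple R L).symm ▸ LieSubmodule.mem_top x
  rw [LieSubmodule.lieIdeal_oper_eq_linear_span'] at hx
  refine Submodule.span_le (p := Submodule.comap ((toEnd R L M).flip m : L →ₗ[R] M)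
    (⁅(⊤ : LieIdeal R L), lieRange R L M⁆).toSubmodule) |>.mpr ?_ hx
  rintro _ ⟨a, -, b, -, rfl⟩
  change ⁅⁅a, b⁆, m⁆ ∈ ⁅(⊤ : LieIdeal R L), lieRange R L M⁆
  rw [lie_lie]
  exact sub_mem (LieSubmodule.lie_mem_lie (LieSubmodule.mem_top a) (lie_mem_lieRange b m))
    (LieSubmodule.lie_mem_lie (LieSubmodule.mem_top b) (lie_mem_lieRange a m))

variable (R L M) in
theorem isTrivial_of_isNilpotent [LieAlgebra.IsSemisimple R L] [LieModule.IsNilpotent L M] :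
    IsTrivial L M := by
  have hle (k : ℕ) : lowerCentralSeries R L M 1 ≤ lowerCentralSeries R L M (k + 1) := by
    induction k with
    | zero => exact le_rfl
    | succ k ih =>
      rw [lowerCentralSeries_succ _ _ _ (k + 1)]
      exact lieRange_le_lie_lieRange.trans (LieSubmodule.mono_lie_right _ ih)
  obtain ⟨k, hk⟩ := IsNilpotent.nilpotent R L M
  rw [trivial_iff_lower_central_eq_bot R, eq_bot_iff]
  exact (hle k).trans ((antitone_lowerCentralSeries R L M k.le_succ).trans hk.le)

end CommRing

section Field

variable {K g W W' : Type*} [Field K] [LieRing g] [LieAlgebra K g]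
  [AddCommGroup W] [Module K W] [LieRingModule g W] [LieModule K g W]
  [AddCommGroup W'] [Module K W'] [LieRingModule g W'] [LieModule K g W']

theorem isTrivial_of_traceForm_eq_zero [CharZero K] [LieAlgebra.IsSemisimple K g]
    [FiniteDimensional K W] (h : traceForm K g W = 0) : IsTrivial g W := by
  have hderived : LieAlgebra.derivedSeries K g 1 = ⊤ := by
    rw [LieAlgebra.derivedSeries_def, LieAlgebra.derivedSeriesOfIdeal_succ,
      LieAlgebra.derivedSeriesOfIdeal_zero, lie_top_top_eq_top_of_isSemisimple]
  have hnil := isNilpotent_derivedSeries_of_traceForm_eq_zero h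
  rw [isNilpotent_iff_forall' (R := K)] at hnil
  have : LieModule.IsNilpotent g W := (isNilpotent_iff_forall' (R := K)).mpr fun x =>
    hnil ⟨x, hderived ▸ LieSubmodule.mem_top x⟩
  exact isTrivial_of_isNilpotent K g W

variable (W) in
/-- The Casimir operator `∑ bᵢ bⁱ` on `W` of an ideal `J` of `g`, for a nondegenerate bilinear form
on `J`; here `(bᵢ)` is a basis of `J` and `(bⁱ)` the dual basis. -/
noncomputable def casimir (J : LieIdeal K g) [FiniteDimensional K J] (B : BilinForm K J)
    (hB : B.Nondegenerate) : Module.End K W :=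
  ∑ i, toEnd K g W (Module.finBasis K J i : J) *
    toEnd K g W (B.dualBasis hB (Module.finBasis K J) i : J)

section Casimir

variable {J : LieIdeal K g} [FiniteDimensional K J] {B : BilinForm K J} (hB : B.Nondegenerate)

theorem casimir_apply (w : W) : casimir W J B hB w =
    ∑ i, ⁅(Module.finBasis K J i : g), ⁅(B.dualBasis hB (Module.finBasis K J) i : g), w⁆⁆ := by
  simp [casimir, LinearMap.sum_apply]

theorem casimir_apply_mem_lieRange (w : W) : casimir W J B hB w ∈ lieRange K g W := by
  rw [casimir_apply]
  exact sum_mem fun i _ => lie_mem_lieRange _ _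

theorem casimir_apply_of_mem_maxTrivSubmodule {w : W} (hw : w ∈ maxTrivSubmodule K g W) :
    casimir W J B hB w = 0 := by
  rw [casimir_apply]
  exact Finset.sum_eq_zero fun i _ => by rw [(mem_maxTrivSubmodule K g W w).mp hw, lie_zero]

theorem casimir_apply_lie (hs : B.IsSymm) (hinv : B.lieInvariant g) (x : g) (w : W) :
    casimir W J B hB ⁅x, w⁆ = ⁅x, casimir W J B hB w⁆ := by
  set b := Module.finBasis K J
  set d := B.dualBasis hB b
  have hdual : B.dualBasis hB d = b := BilinForm.dualBasis_dualBasis hB hs b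
  have hsymm (y z : J) : B y z = B z y := hs.eq y z
  have hb (i) : ⁅x, (b i : g)⁆ = ∑ k, B (d k) ⁅x, b i⁆ • (b k : g) := by
    have h (y : J) : ∑ k, B (d k) y • b k = y := by
      have h := (B.dualBasis hB d).sum_repr y
      simp only [BilinForm.dualBasis_repr_apply, hsymm y] at h
      rwa [hdual] at h
    simpa using congrArg Subtype.val (h ⁅x, b i⁆).symm
  have hd (i) : ⁅x, (d i : g)⁆ = -∑ k, B (d i) ⁅x, b k⁆ • (d k : g) := by
    have h : -∑ k, B (d i) ⁅x, b k⁆ • d k = ⁅x, d i⁆ := by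
      simpa only [BilinForm.dualBasis_repr_apply, hinv x (d i), neg_smul, Finset.sum_neg_distrib,
        d] using d.sum_repr ⁅x, d i⁆
    simpa using congrArg Subtype.val h.symm
  have hcomm (i) : ⁅x, ⁅(b i : g), ⁅(d i : g), w⁆⁆⁆ - ⁅(b i : g), ⁅(d i : g), ⁅x, w⁆⁆⁆ =
      (∑ k, B (d k) ⁅x, b i⁆ • ⁅(b k : g), ⁅(d i : g), w⁆⁆) -
        ∑ k, B (d i) ⁅x, b k⁆ • ⁅(b i : g), ⁅(d k : g), w⁆⁆ := by
    calc _ = ⁅⁅x, (b i : g)⁆, ⁅(d i : g), w⁆⁆ + ⁅(b i : g), ⁅⁅x, (d i : g)⁆, w⁆⁆ := by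
          simp only [lie_lie, lie_sub]; abel
      _ = _ := by
          rw [hb, hd]
          simp only [sum_lie, lie_sum, smul_lie, lie_smul, neg_lie, lie_neg, sub_eq_add_neg]
  rw [eq_comm, ← sub_eq_zero, casimir_apply, casimir_apply, lie_sum, ← Finset.sum_sub_distrib,
    Finset.sum_congr rfl fun i _ => hcomm i, Finset.sum_sub_distrib, Finset.sum_comm, sub_self]

theorem trace_casimir (hs : B.IsSymm) (hBW : ∀ x y : J, B x y = traceForm K g W x y) :
    trace K W (casimir W J B hB) = Module.finrank K J := by
  have htrace (i) : trace K W (toEnd K g W (Module.finBasis K J i : J) *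
      toEnd K g W (B.dualBasis hB (Module.finBasis K J) i : J)) = 1 := by
    have h := BilinForm.apply_dualBasis_right hB hs (Module.finBasis K J) i i
    rwa [hBW, if_pos rfl] at h
  simp [casimir, htrace]

end Casimir

variable (W) in
theorem exists_ideal_nondegenerate_traceForm [LieAlgebra.IsKilling K g] [FiniteDimensional K g] :
    ∃ J : LieIdeal K g, (∀ x, (∀ y ∈ J, traceForm K g W x y = 0) → traceForm K g W x = 0) ∧
      ((traceForm K g W).restrict J.toSubmodule).Nondegenerate := by
  set B := traceForm K g W
  have hsymm (x y : g) : B x y = B y x := traceForm_comm K g W x y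
  let N : LieIdeal K g :=
    LieAlgebra.InvariantForm.orthogonal B (traceForm_lieInvariant K g W) ⊤
  have hN (x : g) : x ∈ N ↔ B x = 0 := by
    simp [N, LieAlgebra.InvariantForm.mem_orthogonal, LinearMap.ext_iff, hsymm x]
  have hJ : IsCompl N N.killingCompl := N.isCompl_killingCompl
  have hker (x : g) (hx : ∀ y ∈ N.killingCompl, B x y = 0) : B x = 0 := by
    ext y
    have hy : y ∈ N ⊔ N.killingCompl := hJ.sup_eq_top ▸ LieSubmodule.mem_top y
    obtain ⟨n, hn, j, hj, rfl⟩ := (LieSubmodule.mem_sup _ _ _).mp hy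
    rw [map_add, hx j hj, hsymm, (hN n).mp hn, LinearMap.zero_apply, LinearMap.zero_apply, add_zero]
  have hzero (x : N.killingCompl) (hx : ∀ y : N.killingCompl, B x y = 0) : x = 0 := by
    have hmem : (x : g) ∈ N ⊓ N.killingCompl :=
      ⟨(hN _).mpr (hker x fun y hy => hx ⟨y, hy⟩), x.2⟩
    simpa [hJ.inf_eq_bot] using hmem
  exact ⟨N.killingCompl, hker, fun x hx => hzero x hx,
    fun x hx => hzero x fun y => (hsymm x y).trans (hx y)⟩

/-- The operator is a Casimir operator; it is not nilpotent because its trace is the dimension of an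
ideal on which the trace form of `W` is nondegenerate. -/
theorem exists_equivariant_not_isNilpotent [CharZero K] [LieAlgebra.IsKilling K g]
    [FiniteDimensional K g] [FiniteDimensional K W] (h : ¬ IsTrivial g W) :
    ∃ C : W →ₗ⁅K,g⁆ W, ¬ IsNilpotent (C : Module.End K W) ∧ (∀ w, C w ∈ lieRange K g W) ∧
      ∀ w ∈ maxTrivSubmodule K g W, C w = 0 := by
  obtain ⟨J, hker, hB⟩ := exists_ideal_nondegenerate_traceForm (K := K) (g := g) W
  let B : BilinForm K J := (traceForm K g W).restrict J.toSubmodule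
  have hs : B.IsSymm := ⟨fun x y => traceForm_comm K g W x y⟩
  have hinv : BilinForm.lieInvariant g B := fun x y z => traceForm_lieInvariant K g W x y z
  refine ⟨{ casimir W J B hB with map_lie' := casimir_apply_lie hB hs hinv _ _ }, fun hnil => h ?_,
    casimir_apply_mem_lieRange hB, fun w hw => casimir_apply_of_mem_maxTrivSubmodule hB hw⟩
  have htrace : (Module.finrank K J : K) = 0 := by
    rw [← trace_casimir (W := W) hB hs fun _ _ => rfl]
    exact (LinearMap.isNilpotent_trace_of_isNilpotent hnil).eq_zero
  have hJ : ∀ y ∈ J, y = 0 := fun y hy => congrArg Subtype.val <|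
    (Module.finrank_zero_iff.mp (by exact_mod_cast htrace : Module.finrank K J = 0)).elim
      (⟨y, hy⟩ : J) 0
  refine isTrivial_of_traceForm_eq_zero (LinearMap.ext fun x => hker x fun y hy => ?_)
  rw [hJ y hy, map_zero]

theorem isCompl_maxTriv_lieRange_of_isCompl {A B : LieSubmodule K g W} (h : IsCompl A B)
    (hA : maxTrivSubmodule K g W ≤ A) (hB : B ≤ lieRange K g W)
    (ih : IsCompl (maxTrivSubmodule K g A) (lieRange K g A)) :
    IsCompl (maxTrivSubmodule K g W) (lieRange K g W) := by
  have hmapTriv : (maxTrivSubmodule K g A).map A.incl = maxTrivSubmodule K g W := by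
    rw [map_incl_maxTrivSubmodule, inf_eq_left.mpr hA]
  have hmapRange : (lieRange K g A).map A.incl = ⁅(⊤ : LieIdeal K g), A⁆ := by
    rw [LieSubmodule.map_bracket_eq, LieSubmodule.map_incl_top]
  constructor
  · have hle : lieRange K g W ≤ ⁅(⊤ : LieIdeal K g), A⁆ ⊔ B := by
      rw [lieRange, ← h.sup_eq_top, LieSubmodule.lie_sup]
      exact sup_le_sup_left (LieSubmodule.lie_le_right _ _) _
    have hinf : A ⊓ (⁅(⊤ : LieIdeal K g), A⁆ ⊔ B) = ⁅(⊤ : LieIdeal K g), A⁆ := by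
      rw [inf_comm, sup_inf_assoc_of_le B (LieSubmodule.lie_le_right A ⊤), inf_comm,
        h.inf_eq_bot, sup_bot_eq]
    rw [disjoint_iff, eq_bot_iff]
    calc maxTrivSubmodule K g W ⊓ lieRange K g W
        ≤ maxTrivSubmodule K g W ⊓ ⁅(⊤ : LieIdeal K g), A⁆ :=
          le_inf inf_le_left ((inf_le_inf hA hle).trans hinf.le)
      _ = (maxTrivSubmodule K g A ⊓ lieRange K g A).map A.incl := by
          rw [LieSubmodule.map_inf A.injective_incl, hmapTriv, hmapRange]
      _ = ⊥ := by rw [ih.inf_eq_bot, LieSubmodule.map_bot]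
  · rw [codisjoint_iff, eq_top_iff, ← h.sup_eq_top]
    refine sup_le ?_ (hB.trans le_sup_right)
    calc A = (maxTrivSubmodule K g A ⊔ lieRange K g A).map A.incl := by
          rw [ih.sup_eq_top, LieSubmodule.map_incl_top]
      _ = maxTrivSubmodule K g W ⊔ ⁅(⊤ : LieIdeal K g), A⁆ := by
          rw [LieSubmodule.map_sup, hmapTriv, hmapRange]
      _ ≤ _ := sup_le_sup_left (LieSubmodule.mono_lie_right _ le_top) _

variable (K g) in
theorem isCompl_maxTriv_lieRange_of_finiteDimensional [CharZero K] [LieAlgebra.IsKilling K g]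
    [FiniteDimensional K g] (W : Type*) [AddCommGroup W] [Module K W] [LieRingModule g W]
    [LieModule K g W] [FiniteDimensional K W] :
    IsCompl (maxTrivSubmodule K g W) (lieRange K g W) := by
  induction hn : Module.finrank K W using Nat.strong_induction_on generalizing W with
  | _ n ih =>
  by_cases htriv : IsTrivial g W
  · have hrange : lieRange K g W = ⊥ :=
      (LieSubmodule.lie_eq_bot_iff _ _).mpr fun x _ w _ => htriv.trivial x w
    rw [(isTrivial_iff_max_triv_eq_top K g W).mp htriv, hrange]
    exact isCompl_top_bot
  obtain ⟨C, hC, hCrange, hCtriv⟩ := exists_equivariant_not_isNilpotent (K := K) htriv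
  obtain ⟨k, hk⟩ := Filter.eventually_atTop.mp
    (LinearMap.eventually_isCompl_ker_pow_range_pow (C : Module.End K W))
  -- Fitting decomposition of `W` with respect to `C`
  let D : W →ₗ⁅K,g⁆ W :=
    { (C : Module.End K W) ^ (k + 1) with
      map_lie' := fun {x w} => by
        have hcomm : Commute (C : Module.End K W) (toEnd K g W x) :=
          LinearMap.ext fun w => C.map_lie x w
        exact LinearMap.congr_fun (hcomm.pow_left (k + 1)).eq w }
  have hD : IsCompl D.ker D.range := by
    rw [← LieSubmodule.isCompl_toSubmodule, LieModuleHom.ker_toSubmodule,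
      LieModuleHom.toSubmodule_range]
    exact hk (k + 1) k.le_succ
  have hlt : Module.finrank K D.ker < n := by
    refine hn ▸ Submodule.finrank_lt (s := D.ker.toSubmodule) fun htop => hC ⟨k + 1, ?_⟩
    exact LinearMap.ker_eq_top.mp htop
  refine isCompl_maxTriv_lieRange_of_isCompl hD (fun w hw => ?_) ?_ (ih _ hlt _ rfl)
  · change ((C : Module.End K W) ^ (k + 1)) w = 0
    rw [pow_succ, Module.End.mul_apply, LieModuleHom.coe_toLinearMap, hCtriv w hw, map_zero]
  · rintro _ ⟨w, rfl⟩
    change ((C : Module.End K W) ^ (k + 1)) w ∈ lieRange K g W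
    rw [pow_succ', Module.End.mul_apply]
    exact hCrange _

end Field

end Weyl

section SimpleModules

open LieModule

variable {R L P V V' : Type*} [CommRing R] [LieRing L]
  [AddCommGroup P] [Module R P] [LieRingModule L P]
  [AddCommGroup V] [Module R V] [LieRingModule L V]
  [AddCommGroup V'] [Module R V'] [LieRingModule L V']

/-- A bijective homomorphism of Lie modules, as an equivalence. -/
noncomputable def equivOfBijective (f : V →ₗ⁅R,L⁆ V') (hf : Function.Bijective f) :
    V ≃ₗ⁅R,L⁆ V' :=
  { f with
    invFun := (LinearEquiv.ofBijective (f : V →ₗ[R] V') hf).symm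
    left_inv := (LinearEquiv.ofBijective (f : V →ₗ[R] V') hf).symm_apply_apply
    right_inv := (LinearEquiv.ofBijective (f : V →ₗ[R] V') hf).apply_symm_apply }

theorem apply_equivOfBijective_symm (f : V →ₗ⁅R,L⁆ V') (hf : Function.Bijective f) (v : V') :
    f ((equivOfBijective f hf).symm v) = v :=
  (equivOfBijective f hf).apply_symm_apply v

theorem exists_comp_eq_of_ker_le (f : P →ₗ⁅R,L⁆ V) (hf : Function.Surjective f)
    (f' : P →ₗ⁅R,L⁆ V') (h : ∀ p, f p = 0 → f' p = 0) : ∃ φ : V →ₗ⁅R,L⁆ V', φ.comp f = f' := by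
  have hker : LinearMap.ker (f : P →ₗ[R] V) ≤ LinearMap.ker (f' : P →ₗ[R] V') := h
  let φ : V →ₗ[R] V' := (LinearMap.ker (f : P →ₗ[R] V)).liftQ (f' : P →ₗ[R] V') hker ∘ₗ
    ((f : P →ₗ[R] V).quotKerEquivOfSurjective hf).symm
  have hφ (p : P) : φ (f p) = f' p := by
    rw [LinearMap.comp_apply, LinearEquiv.coe_coe, ← LieModuleHom.coe_toLinearMap f,
      LinearMap.quotKerEquivOfSurjective_symm_apply, Submodule.liftQ_apply,
      LieModuleHom.coe_toLinearMap]
  refine ⟨{ φ with map_lie' := fun {x v} => ?_ }, LieModuleHom.ext hφ⟩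
  obtain ⟨p, rfl⟩ := hf v
  change φ ⁅x, f p⁆ = ⁅x, φ (f p)⁆
  rw [← f.map_lie, hφ, hφ, f'.map_lie]

theorem injective_of_isIrreducible (hV : IsIrreducible R L V) (f : V →ₗ⁅R,L⁆ V') (hf : f ≠ 0) :
    Function.Injective f := by
  rw [← LieModuleHom.ker_eq_bot]
  refine (hV.eq_bot_or_eq_top f.ker).resolve_right fun h => hf (LieModuleHom.ext fun v => ?_)
  exact LieModuleHom.mem_ker.mp (h ▸ LieSubmodule.mem_top v)

theorem surjective_of_isIrreducible (hV : IsIrreducible R L V') (f : V →ₗ⁅R,L⁆ V') (hf : f ≠ 0) :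
    Function.Surjective f := by
  rw [← LieModuleHom.range_eq_top]
  refine (hV.eq_bot_or_eq_top f.range).resolve_left fun h => hf (LieModuleHom.ext fun v => ?_)
  exact (LieSubmodule.mem_bot (f v)).mp (h ▸ (LieModuleHom.mem_range f _).mpr ⟨v, rfl⟩)

theorem nonempty_equiv_of_ne_zero (hV : IsIrreducible R L V) (hV' : IsIrreducible R L V')
    (f : V →ₗ⁅R,L⁆ V') (hf : f ≠ 0) : Nonempty (V ≃ₗ⁅R,L⁆ V') :=
  ⟨equivOfBijective f ⟨injective_of_isIrreducible hV f hf, surjective_of_isIrreducible hV' f hf⟩⟩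

theorem nonempty_equiv_of_ker_le (hV : IsIrreducible R L V) (hV' : IsIrreducible R L V')
    (f : P →ₗ⁅R,L⁆ V) (hf : f ≠ 0) (f' : P →ₗ⁅R,L⁆ V') (hf' : f' ≠ 0)
    (h : ∀ p, f p = 0 → f' p = 0) : Nonempty (V ≃ₗ⁅R,L⁆ V') := by
  obtain ⟨φ, rfl⟩ := exists_comp_eq_of_ker_le f (surjective_of_isIrreducible hV f hf) f' h
  refine nonempty_equiv_of_ne_zero hV hV' φ fun h0 => hf' ?_
  rw [h0]
  rfl

theorem isIrreducible_of_isAtom {N : LieSubmodule R L V} (h : IsAtom N) : IsIrreducible R L N := by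
  have : Nontrivial N := (LieSubmodule.nontrivial_iff_ne_bot R L V).mpr h.1
  have hinj := LieSubmodule.map_injective_of_injective N.injective_incl
  refine LieModule.IsIrreducible.mk fun S hS => hinj ?_
  have hle : S.map N.incl ≤ N := (LieSubmodule.map_mono le_top).trans_eq N.map_incl_top
  have hne : S.map N.incl ≠ ⊥ := fun h0 => hS (hinj (h0.trans LieSubmodule.map_bot.symm))
  rw [(h.le_iff.mp hle).resolve_left hne, N.map_incl_top]

theorem exists_leftInverse_of_injective [LieAlgebra R L] [LieModule R L V]
    [ComplementedLattice (LieSubmodule R L V)] (j : P →ₗ⁅R,L⁆ V) (hj : Function.Injective j) :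
    ∃ r : V →ₗ⁅R,L⁆ P, ∀ p, r (j p) = p := by
  obtain ⟨C, hC⟩ := exists_isCompl j.range
  let π := LieSubmodule.Quotient.mk' C
  have hbij : Function.Bijective (π.comp j) := by
    constructor
    · refine (injective_iff_map_eq_zero _).mpr fun p hp => (map_eq_zero_iff j hj).mp ?_
      have hpC : j p ∈ C := (LieSubmodule.Quotient.mk_eq_zero' (N := C)).mp hp
      exact (LieSubmodule.mem_bot _).mp
        (hC.disjoint.le_bot ⟨(LieModuleHom.mem_range _ _).mpr ⟨p, rfl⟩, hpC⟩)
    · intro q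
      obtain ⟨v, rfl⟩ := LieSubmodule.Quotient.surjective_mk' C q
      obtain ⟨w, hw, c, hc, rfl⟩ := (LieSubmodule.mem_sup _ _ _).mp
        (hC.sup_eq_top ▸ LieSubmodule.mem_top v)
      obtain ⟨p, rfl⟩ := (LieModuleHom.mem_range _ _).mp hw
      have hπc : π c = 0 := (LieSubmodule.Quotient.mk_eq_zero' (N := C)).mpr hc
      exact ⟨p, by rw [map_add, hπc, add_zero, LieModuleHom.comp_apply]⟩
  exact ⟨(equivOfBijective _ hbij).symm.toLieModuleHom.comp π,
    (equivOfBijective _ hbij).symm_apply_apply⟩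

theorem exists_rightInverse_of_surjective [ComplementedLattice (LieSubmodule R L V)]
    (f : V →ₗ⁅R,L⁆ P) (hf : Function.Surjective f) : ∃ s : P →ₗ⁅R,L⁆ V, ∀ p, f (s p) = p := by
  obtain ⟨C, hC⟩ := exists_isCompl f.ker
  have hbij : Function.Bijective (f.comp C.incl) := by
    constructor
    · refine (injective_iff_map_eq_zero _).mpr fun c hc => Subtype.ext ?_
      exact (LieSubmodule.mem_bot _).mp (hC.disjoint.le_bot ⟨LieModuleHom.mem_ker.mpr hc, c.2⟩)
    · intro p
      obtain ⟨v, rfl⟩ := hf p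
      obtain ⟨k, hk, c, hc, rfl⟩ := (LieSubmodule.mem_sup _ _ _).mp
        (hC.sup_eq_top ▸ LieSubmodule.mem_top v)
      refine ⟨⟨c, hc⟩, ?_⟩
      rw [map_add, LieModuleHom.mem_ker.mp hk, zero_add]
      rfl
  exact ⟨C.incl.comp (equivOfBijective _ hbij).symm.toLieModuleHom,
    apply_equivOfBijective_symm _ hbij⟩

end SimpleModules

section Independence

open LieModule

variable {R L P ι : Type*} [CommRing R] [LieRing L] [AddCommGroup P] [Module R P]
  [LieRingModule L P] {V : ι → Type*} [∀ i, AddCommGroup (V i)]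
  [∀ i, Module R (V i)] [∀ i, LieRingModule L (V i)]

theorem exists_ne_zero_of_notMem (hV : ∀ i, IsIrreducible R L (V i)) (f : ∀ i, P →ₗ⁅R,L⁆ V i)
    (hf : ∀ i, f i ≠ 0) (hne : ∀ i j, Nonempty (V i ≃ₗ⁅R,L⁆ V j) → i = j) (s : Finset ι) :
    ∀ i ∉ s, ∃ p, (∀ j ∈ s, f j p = 0) ∧ f i p ≠ 0 := by
  classical
  induction s using Finset.induction_on with
  | empty =>
    intro i _
    obtain ⟨p, hp⟩ := DFunLike.ne_iff.mp (hf i)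
    exact ⟨p, by simp, hp⟩
  | insert m s hms ih =>
    intro i hi
    rw [Finset.mem_insert, not_or] at hi
    by_contra! hcon
    let S : LieSubmodule R L P := ⨅ j : s, (f j).ker
    have hS (p : P) : p ∈ S ↔ ∀ j ∈ s, f j p = 0 := by simp [S, LieSubmodule.mem_iInf]
    have hne_zero (k : ι) (hk : k ∉ s) : (f k).comp S.incl ≠ 0 := fun h0 => by
      obtain ⟨p, hp, hp'⟩ := ih k hk
      exact hp' (LieModuleHom.congr_fun h0 ⟨p, (hS p).mpr hp⟩)
    refine hi.1 (hne m i (nonempty_equiv_of_ker_le (hV m) (hV i) ((f m).comp S.incl)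
      (hne_zero m hms) ((f i).comp S.incl) (hne_zero i hi.2)
      fun p hp => hcon p fun j hj => ?_)).symm
    rcases Finset.mem_insert.mp hj with rfl | hj
    exacts [hp, (hS p).mp p.2 j hj]

end Independence

section LocallyFinite

open LieModule Module

variable {K g W W' M : Type*} [Field K] [LieRing g]
  [AddCommGroup W] [Module K W] [LieRingModule g W]
  [AddCommGroup W'] [Module K W'] [LieRingModule g W']
  [AddCommGroup M] [Module K M] [LieRingModule g M]

variable (K g W) in
/-- A module is locally finite if every vector lies in a finite-dimensional submodule. -/
def LocFin : Prop :=
  ∀ w : W, ∃ N : LieSubmodule K g W, FiniteDimensional K N ∧ w ∈ N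

theorem finiteDimensional_sup (N N' : LieSubmodule K g W) [FiniteDimensional K N]
    [FiniteDimensional K N'] : FiniteDimensional K (N ⊔ N' : LieSubmodule K g W) :=
  Submodule.finite_sup N.toSubmodule N'.toSubmodule

theorem LocFin.of_finiteDimensional [FiniteDimensional K W] : LocFin K g W := fun w =>
  ⟨⊤, inferInstanceAs (FiniteDimensional K (⊤ : Submodule K W)), LieSubmodule.mem_top w⟩

theorem LocFin.of_surjective (h : LocFin K g W) (f : W →ₗ⁅K,g⁆ W') (hf : Function.Surjective f) :
    LocFin K g W' := by
  intro w'
  obtain ⟨w, rfl⟩ := hf w'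
  obtain ⟨N, hN, hw⟩ := h w
  exact ⟨N.map f, Module.Finite.map N.toSubmodule (f : W →ₗ[K] W'), LieSubmodule.mem_map_of_mem hw⟩

theorem LocFin.of_injective (h : LocFin K g W') (f : W →ₗ⁅K,g⁆ W') (hf : Function.Injective f) :
    LocFin K g W := by
  intro w
  obtain ⟨N, hN, hw⟩ := h (f w)
  let φ : N.comap f →ₗ[K] N :=
    (f : W →ₗ[K] W').restrict (p := (N.comap f).toSubmodule) (q := N.toSubmodule) fun _ hx => hx
  exact ⟨N.comap f, Module.Finite.of_injective φ fun x y hxy =>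
    Subtype.ext (hf (congrArg Subtype.val hxy)), hw⟩

theorem LocFin.lieSubmodule (h : LocFin K g W) (N : LieSubmodule K g W) : LocFin K g N :=
  h.of_injective N.incl N.injective_incl

theorem LocFin.exists_le (h : LocFin K g W) (S : Submodule K W) (hS : S.FG) :
    ∃ N : LieSubmodule K g W, FiniteDimensional K N ∧ S ≤ N.toSubmodule := by
  induction S, hS using Submodule.fg_induction with
  | singleton w =>
    obtain ⟨N, hN, hw⟩ := h w
    exact ⟨N, hN, (Submodule.span_singleton_le_iff_mem w N.toSubmodule).mpr hw⟩
  | sup S T _ _ hS hT =>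
    obtain ⟨N, hN, hSN⟩ := hS
    obtain ⟨N', hN', hTN'⟩ := hT
    exact ⟨N ⊔ N', finiteDimensional_sup N N', sup_le_sup hSN hTN'⟩

theorem LocFin.finiteDimensional_of_isIrreducible (h : LocFin K g W) (hW : IsIrreducible K g W) :
    FiniteDimensional K W := by
  have := LieModule.nontrivial_of_isIrreducible K g W
  obtain ⟨w, hw⟩ := exists_ne (0 : W)
  obtain ⟨N, hN, hwN⟩ := h w
  obtain rfl : N = ⊤ := (hW.eq_bot_or_eq_top N).resolve_left fun h0 => hw <| by
    rwa [h0, LieSubmodule.mem_bot] at hwN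
  exact Module.Finite.equiv (LinearEquiv.ofTop (⊤ : Submodule K W) rfl)

variable [LieAlgebra K g] [LieModule K g W] [LieModule K g W'] [LieModule K g M]

/-- Composition with `f`, as a homomorphism between Lie modules of linear maps. -/
def postcomp (M : Type*) [AddCommGroup M] [Module K M] [LieRingModule g M] [LieModule K g M]
    (f : W →ₗ⁅K,g⁆ W') : (M →ₗ[K] W) →ₗ⁅K,g⁆ (M →ₗ[K] W') :=
  { LinearMap.compRight K (f : W →ₗ[K] W') with
    map_lie' := fun {x φ} => LinearMap.ext fun m => by simp }

/-- Precomposition with `f`, as a homomorphism between Lie modules of linear maps. -/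
def precomp (W : Type*) [AddCommGroup W] [Module K W] [LieRingModule g W] [LieModule K g W]
    (f : M →ₗ⁅K,g⁆ W') : (W' →ₗ[K] W) →ₗ⁅K,g⁆ (M →ₗ[K] W) :=
  { LinearMap.lcomp K W (f : M →ₗ[K] W') with
    map_lie' := fun {x φ} => LinearMap.ext fun m => by simp }

theorem LocFin.hom (h : LocFin K g W) [FiniteDimensional K M] : LocFin K g (M →ₗ[K] W) := by
  intro φ
  obtain ⟨N, hN, hφ⟩ := h.exists_le φ.range (Submodule.FG.of_finite)
  refine ⟨(postcomp M N.incl).range,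
    Module.Finite.range (postcomp M N.incl : (M →ₗ[K] N) →ₗ[K] (M →ₗ[K] W)),
    (LieModuleHom.mem_range _ _).mpr ⟨φ.codRestrict N.toSubmodule fun m => hφ ⟨m, rfl⟩, rfl⟩⟩

theorem LocFin.tensor (h : LocFin K g W) (h' : LocFin K g W') : LocFin K g (W ⊗[K] W') := by
  intro t
  induction t using TensorProduct.induction_on with
  | zero => exact ⟨⊥, inferInstanceAs (FiniteDimensional K (⊥ : Submodule K _)), zero_mem _⟩
  | tmul w w' =>
    obtain ⟨N, hN, hw⟩ := h w
    obtain ⟨N', hN', hw'⟩ := h' w'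
    let f := TensorProduct.LieModule.mapIncl N N'
    exact ⟨f.range, Module.Finite.range (f : N ⊗[K] N' →ₗ[K] W ⊗[K] W'),
      (LieModuleHom.mem_range _ _).mpr ⟨⟨w, hw⟩ ⊗ₜ ⟨w', hw'⟩, by simp [f]⟩⟩
  | add s t hs ht =>
    obtain ⟨N, hN, hs⟩ := hs
    obtain ⟨N', hN', ht⟩ := ht
    exact ⟨N ⊔ N', finiteDimensional_sup N N',
      add_mem (LieSubmodule.mem_sup_left hs) (LieSubmodule.mem_sup_right ht)⟩

theorem LocFin.exists_mem_lieRange (h : LocFin K g W) {w : W} (hw : w ∈ lieRange K g W) :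
    ∃ N : LieSubmodule K g W, FiniteDimensional K N ∧ ∃ a ∈ lieRange K g N, (a : W) = w := by
  rw [← LieSubmodule.mem_toSubmodule, LieSubmodule.lieIdeal_oper_eq_linear_span'] at hw
  induction hw using Submodule.span_induction with
  | mem u hu =>
    obtain ⟨x, -, v, -, rfl⟩ := hu
    obtain ⟨N, hN, hv⟩ := h v
    exact ⟨N, hN, ⁅x, (⟨v, hv⟩ : N)⁆, lie_mem_lieRange _ _, rfl⟩
  | zero =>
    exact ⟨⊥, inferInstanceAs (FiniteDimensional K (⊥ : Submodule K _)), 0, zero_mem _, rfl⟩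
  | add u v _ _ hu hv =>
    obtain ⟨N, hN, a, ha, rfl⟩ := hu
    obtain ⟨N', hN', a', ha', rfl⟩ := hv
    exact ⟨N ⊔ N', finiteDimensional_sup N N',
      LieSubmodule.inclusion le_sup_left a + LieSubmodule.inclusion le_sup_right a',
      add_mem (map_mem_lieRange _ ha) (map_mem_lieRange _ ha'), rfl⟩
  | smul t u _ hu =>
    obtain ⟨N, hN, a, ha, rfl⟩ := hu
    exact ⟨N, hN, t • a, SMulMemClass.smul_mem _ ha, rfl⟩

variable [CharZero K] [FiniteDimensional K g] [LieAlgebra.IsKilling K g]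

theorem LocFin.isCompl (h : LocFin K g W) :
    IsCompl (maxTrivSubmodule K g W) (lieRange K g W) := by
  constructor
  · rw [disjoint_iff, LieSubmodule.eq_bot_iff]
    rintro w ⟨hinv, hrange⟩
    obtain ⟨N, hN, a, ha, rfl⟩ := h.exists_mem_lieRange hrange
    have ha' : a ∈ maxTrivSubmodule K g N := fun x => Subtype.ext (hinv x)
    have ha₀ := (isCompl_maxTriv_lieRange_of_finiteDimensional K g N).disjoint.le_bot ⟨ha', ha⟩
    rw [(LieSubmodule.mem_bot a).mp ha₀, ZeroMemClass.coe_zero]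
  · rw [codisjoint_iff, eq_top_iff]
    intro w _
    obtain ⟨N, hN, hw⟩ := h w
    have hw' : (⟨w, hw⟩ : N) ∈ maxTrivSubmodule K g N ⊔ lieRange K g N := by
      rw [(isCompl_maxTriv_lieRange_of_finiteDimensional K g N).sup_eq_top]
      exact LieSubmodule.mem_top _
    obtain ⟨s, hs, t, ht, hst⟩ := (LieSubmodule.mem_sup _ _ _).mp hw'
    exact (LieSubmodule.mem_sup _ _ _).mpr ⟨s, map_mem_maxTrivSubmodule N.incl hs, t,
      map_mem_lieRange N.incl ht, congrArg Subtype.val hst⟩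

/-- The Reynolds operator: the projection of a locally finite module onto its invariants along
`g W`. -/
noncomputable def LocFin.reynolds (h : LocFin K g W) : W →ₗ[K] W :=
  Submodule.projection _ _ (LieSubmodule.isCompl_toSubmodule.mpr h.isCompl)

theorem LocFin.reynolds_mem (h : LocFin K g W) (w : W) :
    h.reynolds w ∈ maxTrivSubmodule K g W :=
  Submodule.projection_apply_mem _ w

theorem LocFin.reynolds_eq (h : LocFin K g W) {w : W} (hw : w ∈ maxTrivSubmodule K g W) :
    h.reynolds w = w :=
  Submodule.projection_apply_left (LieSubmodule.isCompl_toSubmodule.mpr h.isCompl) ⟨w, hw⟩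

theorem LocFin.reynolds_eq_zero_iff (h : LocFin K g W) {w : W} :
    h.reynolds w = 0 ↔ w ∈ lieRange K g W :=
  Submodule.projection_apply_eq_zero_iff (LieSubmodule.isCompl_toSubmodule.mpr h.isCompl)

theorem LocFin.map_reynolds (h : LocFin K g W) (h' : LocFin K g W') (f : W →ₗ⁅K,g⁆ W') (w : W) :
    f (h.reynolds w) = h'.reynolds (f w) := by
  have hinv := h'.reynolds_eq (map_mem_maxTrivSubmodule f (h.reynolds_mem w))
  have hrange : w - h.reynolds w ∈ lieRange K g W := by
    rw [← h.reynolds_eq_zero_iff, map_sub, h.reynolds_eq (h.reynolds_mem w), sub_self]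
  have hzero := h'.reynolds_eq_zero_iff.mpr (map_mem_lieRange f hrange)
  rw [map_sub, map_sub, hinv, sub_eq_zero] at hzero
  exact hzero.symm

theorem LocFin.reynolds_mem_of_mem (h : LocFin K g W) (N : LieSubmodule K g W) {w : W}
    (hw : w ∈ N) : h.reynolds w ∈ N := by
  have hN := (h.lieSubmodule N).map_reynolds h N.incl ⟨w, hw⟩
  exact (show h.reynolds w = _ from hN.symm) ▸ ((h.lieSubmodule N).reynolds ⟨w, hw⟩).2

theorem LocFin.exists_invariant_lift (h : LocFin K g W) (f : W →ₗ⁅K,g⁆ W')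
    (hf : Function.Surjective f) {w' : W'} (hw' : w' ∈ maxTrivSubmodule K g W') :
    ∃ w ∈ maxTrivSubmodule K g W, f w = w' := by
  obtain ⟨w, rfl⟩ := hf w'
  have h' := h.of_surjective f hf
  exact ⟨h.reynolds w, h.reynolds_mem w, by rw [h.map_reynolds h', h'.reynolds_eq hw']⟩

theorem exists_equivariant_projection [FiniteDimensional K W] (S : LieSubmodule K g W) :
    ∃ p : W →ₗ⁅K,g⁆ S, ∀ s : S, p s = s := by
  have hsurj : Function.Surjective (precomp S S.incl) := fun φ => by
    obtain ⟨q, hq⟩ :=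
      S.toSubmodule.subtype.exists_leftInverse_of_injective S.toSubmodule.ker_subtype
    exact ⟨φ ∘ₗ q, LinearMap.ext fun s => congrArg φ (LinearMap.congr_fun hq s)⟩
  obtain ⟨p, hp, hp'⟩ := (LocFin.of_finiteDimensional (K := K) (g := g)).exists_invariant_lift
    (precomp S S.incl) hsurj (maxTrivLinearMapEquivLieModuleHom.symm LieModuleHom.id).2
  exact ⟨maxTrivLinearMapEquivLieModuleHom ⟨p, hp⟩, fun s => LinearMap.congr_fun hp' s⟩

theorem complementedLattice_of_finiteDimensional [FiniteDimensional K W] :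
    ComplementedLattice (LieSubmodule K g W) where
  exists_isCompl S := by
    obtain ⟨p, hp⟩ := exists_equivariant_projection S
    refine ⟨p.ker, LieSubmodule.isCompl_toSubmodule.mp ?_⟩
    rw [LieModuleHom.ker_toSubmodule]
    exact LinearMap.isCompl_of_proj (f := (p : W →ₗ[K] S)) hp

/-- Submodules of `N` are the submodules of the ambient module contained in `N`. -/
def submoduleOrderIsoIic (N : LieSubmodule K g W) : LieSubmodule K g N ≃o Set.Iic N where
  toFun S := ⟨S.map N.incl, (LieSubmodule.map_mono le_top).trans_eq N.map_incl_top⟩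
  invFun S := S.1.comap N.incl
  left_inv S := S.comap_map_eq N.incl N.ker_incl
  right_inv S := Subtype.ext ((LieSubmodule.map_comap_incl N S.1).trans (inf_eq_right.mpr S.2))
  map_rel_iff' := LieSubmodule.map_le_map_iff N.injective_incl

theorem LocFin.complementedLattice (h : LocFin K g W) :
    ComplementedLattice (LieSubmodule K g W) := by
  refine complementedLattice_of_complementedLattice_Iic (f := id)
    (s := {N : LieSubmodule K g W | FiniteDimensional K N}) (fun N hN => ?_) ?_
  · have : FiniteDimensional K N := hN
    have := complementedLattice_of_finiteDimensional (K := K) (g := g) (W := N)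
    exact (submoduleOrderIsoIic N).complementedLattice
  · refine eq_top_iff.mpr fun w _ => ?_
    obtain ⟨N, hN, hw⟩ := h w
    exact (le_iSup₂ (f := fun (N : LieSubmodule K g W) _ => N) N hN) hw

theorem LocFin.exists_isInternal (h : LocFin K g W) :
    ∃ s : Set (LieSubmodule K g W),
      (∀ i : s, IsIrreducible K g i.1 ∧ FiniteDimensional K i.1) ∧
      ∀ [DecidableEq s], DirectSum.IsInternal (fun i : s => i.1.toSubmodule) := by
  have := h.complementedLattice
  obtain ⟨s, hind, hsup, hatom⟩ :=
    exists_sSupIndep_of_sSup_atoms_eq_top (sSup_atoms_eq_top (α := LieSubmodule K g W))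
  refine ⟨s, fun i => ?_, DirectSum.isInternal_submodule_of_iSupIndep_of_iSup_eq_top
    (LieSubmodule.iSupIndep_toSubmodule.mpr ((sSupIndep_iff _).mp hind)) ?_⟩
  · have hi := isIrreducible_of_isAtom (hatom i.2)
    exact ⟨hi, (h.lieSubmodule i.1).finiteDimensional_of_isIrreducible hi⟩
  · rw [LieSubmodule.iSup_toSubmodule_eq_top, ← sSup_eq_iSup', hsup]

end LocallyFinite

section EnvelopingAlgebra

open LieModule UniversalEnvelopingAlgebra

attribute [local instance] LieRing.ofAssociativeRing

variable {R L : Type*} [CommRing R] [LieRing L] [LieAlgebra R L]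

theorem ι_lie (x y : L) : ι R ⁅x, y⁆ = ι R x * ι R y - ι R y * ι R x := by
  rw [LieHom.map_lie, LieRing.of_associative_ring_bracket]

theorem adjoin_range_ι :
    Algebra.adjoin R (Set.range (ι R : L → UniversalEnvelopingAlgebra R L)) = ⊤ := by
  set S := Algebra.adjoin R (Set.range (ι R : L → UniversalEnvelopingAlgebra R L))
  let f : L →ₗ⁅R⁆ S :=
    { toFun := fun x => ⟨ι R x, Algebra.subset_adjoin ⟨x, rfl⟩⟩
      map_add' := fun x y => Subtype.ext (map_add (ι R) x y)
      map_smul' := fun t x => Subtype.ext (map_smul (ι R) t x)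
      map_lie' := fun {x y} => Subtype.ext (ι_lie x y) }
  have hf : S.val.comp (lift R f) = AlgHom.id R _ := by
    apply hom_ext
    ext x
    change ((lift R f (ι R x) : S) : UniversalEnvelopingAlgebra R L) = ι R x
    rw [lift_ι_apply]
    rfl
  refine eq_top_iff.mpr fun u _ => ?_
  rw [← show ((lift R f u : S) : UniversalEnvelopingAlgebra R L) = u from AlgHom.congr_fun hf u]
  exact (lift R f u).2

theorem env_induction {C : UniversalEnvelopingAlgebra R L → Prop}
    (algebraMap : ∀ c : R, C (algebraMap R _ c)) (ι : ∀ x : L, C (ι R x))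
    (mul : ∀ u v, C u → C v → C (u * v)) (add : ∀ u v, C u → C v → C (u + v))
    (u : UniversalEnvelopingAlgebra R L) : C u := by
  have hu : u ∈ Algebra.adjoin R (Set.range (UniversalEnvelopingAlgebra.ι R : L → _)) := by
    rw [adjoin_range_ι]
    trivial
  induction hu using Algebra.adjoin_induction with
  | mem x hx => obtain ⟨y, rfl⟩ := hx; exact ι y
  | algebraMap r => exact algebraMap r
  | add x y _ _ hx hy => exact add _ _ hx hy
  | mul x y _ _ hx hy => exact mul _ _ hx hy

noncomputable instance : LieRingModule L (UniversalEnvelopingAlgebra R L) :=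
  LieRingModule.compLieHom _ (ι R : L →ₗ⁅R⁆ UniversalEnvelopingAlgebra R L)

instance : LieModule R L (UniversalEnvelopingAlgebra R L) :=
  LieModule.compLieHom _ (ι R : L →ₗ⁅R⁆ UniversalEnvelopingAlgebra R L)

theorem lie_env (x : L) (u : UniversalEnvelopingAlgebra R L) : ⁅x, u⁆ = ι R x * u - u * ι R x :=
  rfl

theorem lie_mul_env (x : L) (u v : UniversalEnvelopingAlgebra R L) :
    ⁅x, u * v⁆ = ⁅x, u⁆ * v + u * ⁅x, v⁆ := by
  simp only [lie_env]
  noncomm_ring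

theorem lie_algebraMap_env (x : L) (c : R) :
    ⁅x, algebraMap R (UniversalEnvelopingAlgebra R L) c⁆ = 0 := by
  rw [lie_env, Algebra.commutes, sub_self]

section Act

variable {N N' : Type*} [AddCommGroup N] [Module R N] [LieRingModule L N] [LieModule R L N]
  [AddCommGroup N'] [Module R N'] [LieRingModule L N'] [LieModule R L N']

/-- The action of the enveloping algebra of `L` on an `L`-module. -/
noncomputable abbrev act (N : Type*) [AddCommGroup N] [Module R N] [LieRingModule L N]
    [LieModule R L N] : UniversalEnvelopingAlgebra R L →ₐ[R] Module.End R N :=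
  lift R (toEnd R L N)

theorem act_ι (x : L) (n : N) : act N (ι R x) n = ⁅x, n⁆ := by
  rw [act, lift_ι_apply, toEnd_apply_apply]

theorem act_mul (u v : UniversalEnvelopingAlgebra R L) (n : N) :
    act N (u * v) n = act N u (act N v n) := by
  rw [map_mul, Module.End.mul_apply]

theorem act_algebraMap (c : R) (n : N) :
    act N (algebraMap R (UniversalEnvelopingAlgebra R L) c) n = c • n := by
  rw [AlgHom.commutes, Module.algebraMap_end_apply]

theorem act_lie (x : L) (u : UniversalEnvelopingAlgebra R L) (n : N) :
    act N ⁅x, u⁆ n = ⁅x, act N u n⁆ - act N u ⁅x, n⁆ := by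
  rw [lie_env, map_sub, LinearMap.sub_apply, act_mul, act_mul, act_ι, act_ι]

theorem act_mem (S : LieSubmodule R L N) (u : UniversalEnvelopingAlgebra R L) :
    ∀ n ∈ S, act N u n ∈ S := by
  induction u using env_induction with
  | algebraMap c => intro n hn; rw [act_algebraMap]; exact S.smul_mem c hn
  | ι x => intro n hn; rw [act_ι]; exact S.lie_mem hn
  | mul u v hu hv => intro n hn; rw [act_mul]; exact hu _ (hv _ hn)
  | add u v hu hv =>
    intro n hn; rw [map_add, LinearMap.add_apply]; exact add_mem (hu _ hn) (hv _ hn)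

/-- The left ideal of the enveloping algebra annihilating `n`. -/
noncomputable def leftAnnihilator (n : N) :
    Submodule (UniversalEnvelopingAlgebra R L) (UniversalEnvelopingAlgebra R L) where
  carrier := {u | act N u n = 0}
  add_mem' {u v} hu hv := by
    change act N (u + v) n = 0
    rw [map_add, LinearMap.add_apply, show act N u n = 0 from hu, show act N v n = 0 from hv,
      add_zero]
  zero_mem' := by
    change act N 0 n = 0
    rw [map_zero, LinearMap.zero_apply]
  smul_mem' u {v} hv := by
    change act N (u * v) n = 0
    rw [act_mul, show act N v n = 0 from hv, map_zero]

theorem map_act (f : N →ₗ⁅R,L⁆ N') (u : UniversalEnvelopingAlgebra R L) :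
    ∀ n : N, f (act N u n) = act N' u (f n) := by
  induction u using env_induction with
  | algebraMap c => intro n; rw [act_algebraMap, act_algebraMap, map_smul]
  | ι x => intro n; rw [act_ι, act_ι, LieModuleHom.map_lie]
  | mul u v hu hv => intro n; rw [act_mul, act_mul, hu, hv]
  | add u v hu hv =>
    intro n; rw [map_add, LinearMap.add_apply, map_add, hu, hv, map_add, LinearMap.add_apply]

end Act

/-- The subalgebra of the enveloping algebra `U(L)` generated by an ideal `I` of `L`; over a field
it is the enveloping algebra of `I`. -/
noncomputable def idealEnv (I : LieIdeal R L) : Subalgebra R (UniversalEnvelopingAlgebra R L) :=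
  Algebra.adjoin R (ι R '' (I : Set L))

variable {I : LieIdeal R L}

theorem ι_mem_idealEnv {x : L} (hx : x ∈ I) : ι R x ∈ idealEnv I :=
  Algebra.subset_adjoin ⟨x, hx, rfl⟩

theorem lie_mem_idealEnv (x : L) {a : UniversalEnvelopingAlgebra R L} (ha : a ∈ idealEnv I) :
    ⁅x, a⁆ ∈ idealEnv I := by
  induction ha using Algebra.adjoin_induction with
  | mem y hy =>
    obtain ⟨y, hy, rfl⟩ := hy
    rw [lie_env, ← ι_lie]
    exact ι_mem_idealEnv (lie_mem_right R L _ x y hy)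
  | algebraMap r => rw [lie_algebraMap_env]; exact zero_mem _
  | add a b _ _ ha hb => rw [lie_add]; exact add_mem ha hb
  | mul a b ha' hb' ha hb => rw [lie_mul_env]; exact add_mem (mul_mem ha hb') (mul_mem ha' hb)

variable (I) in
/-- The subalgebra generated by an ideal, as a submodule for the adjoint action. -/
noncomputable def idealEnvLie : LieSubmodule R L (UniversalEnvelopingAlgebra R L) :=
  { Subalgebra.toSubmodule (idealEnv I) with lie_mem := fun ha => lie_mem_idealEnv _ ha }

noncomputable instance : LieRingModule L (idealEnv I) :=
  inferInstanceAs (LieRingModule L (idealEnvLie I))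

instance : LieModule R L (idealEnv I) :=
  inferInstanceAs (LieModule R L (idealEnvLie I))

theorem coe_lie_idealEnv (x : L) (a : idealEnv I) :
    ((⁅x, a⁆ : idealEnv I) : UniversalEnvelopingAlgebra R L) = ι R x * a - a * ι R x :=
  rfl

theorem lie_mul_idealEnv (x : L) (a b : idealEnv I) : ⁅x, a * b⁆ = ⁅x, a⁆ * b + a * ⁅x, b⁆ :=
  Subtype.ext (lie_mul_env x (a : UniversalEnvelopingAlgebra R L) b)

theorem commute_of_mem_idealEnv [IsLieAbelian I] :
    ∀ a ∈ ι R '' (I : Set L), ∀ b ∈ ι R '' (I : Set L), a * b = b * a := by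
  rintro _ ⟨x, hx, rfl⟩ _ ⟨y, hy, rfl⟩
  have hxy : ⁅x, y⁆ = 0 := congrArg Subtype.val (trivial_lie_zero I I ⟨x, hx⟩ ⟨y, hy⟩)
  rw [← sub_eq_zero, ← ι_lie, hxy, map_zero]

noncomputable instance [IsLieAbelian I] : CommRing (idealEnv I) :=
  { (inferInstance : Ring (idealEnv I)) with
    mul_comm := (Algebra.isMulCommutative_adjoin R commute_of_mem_idealEnv).is_comm.comm }

theorem idealEnv_fg [IsNoetherian R L] : (idealEnv I).FG := by
  classical
  obtain ⟨S, hS⟩ := IsNoetherian.noetherian I.toSubmodule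
  refine ⟨S.image (ι R : L → UniversalEnvelopingAlgebra R L), ?_⟩
  have hspan := Submodule.map_span
    ((ι R : L →ₗ⁅R⁆ UniversalEnvelopingAlgebra R L) : L →ₗ[R] UniversalEnvelopingAlgebra R L)
    (S : Set L)
  rw [hS] at hspan
  rw [Finset.coe_image, ← Algebra.adjoin_span]
  exact (congrArg (Algebra.adjoin R) (congrArg SetLike.coe hspan)).symm

instance [IsLieAbelian I] [IsNoetherianRing R] [IsNoetherian R L] :
    IsNoetherianRing (idealEnv I) :=
  have : Algebra.FiniteType R (idealEnv I) := (idealEnv I).fg_iff_finiteType.mp idealEnv_fg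
  Algebra.FiniteType.isNoetherianRing R (idealEnv I)

end EnvelopingAlgebra

section LocallyFiniteEnv

open LieModule UniversalEnvelopingAlgebra

attribute [local instance] LieRing.ofAssociativeRing

variable {K L : Type*} [Field K] [LieRing L] [LieAlgebra K L]

theorem LocFin.mul_mem_env {N N' : LieSubmodule K L (UniversalEnvelopingAlgebra K L)}
    [FiniteDimensional K N] [FiniteDimensional K N'] {u v : UniversalEnvelopingAlgebra K L}
    (hu : u ∈ N) (hv : v ∈ N') :
    ∃ T : LieSubmodule K L (UniversalEnvelopingAlgebra K L), FiniteDimensional K T ∧ u * v ∈ T := by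
  let μ : UniversalEnvelopingAlgebra K L →ₗ⁅K,L⁆
      UniversalEnvelopingAlgebra K L →ₗ[K] UniversalEnvelopingAlgebra K L :=
    { LinearMap.mul K (UniversalEnvelopingAlgebra K L) with
      map_lie' := fun {x u} => LinearMap.ext fun v => by
        change ⁅x, u⁆ * v = ⁅x, u * v⁆ - u * ⁅x, v⁆
        rw [lie_mul_env, add_sub_cancel_right] }
  let f := (TensorProduct.LieModule.liftLie K L _ _ _ μ).comp
    (TensorProduct.LieModule.mapIncl N N')
  refine ⟨f.range, Module.Finite.range (f : N ⊗[K] N' →ₗ[K] UniversalEnvelopingAlgebra K L),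
    (LieModuleHom.mem_range _ _).mpr ⟨⟨u, hu⟩ ⊗ₜ ⟨v, hv⟩, ?_⟩⟩
  simp only [f, LieModuleHom.comp_apply, TensorProduct.LieModule.mapIncl_def,
    TensorProduct.LieModule.map_tmul, TensorProduct.LieModule.liftLie_apply]
  rfl

theorem locFin_env [FiniteDimensional K L] : LocFin K L (UniversalEnvelopingAlgebra K L) := by
  intro u
  induction u using env_induction with
  | algebraMap c =>
    refine ⟨{ (K ∙ (1 : UniversalEnvelopingAlgebra K L)) with lie_mem := fun {x m} hm => ?_ }, ?_,
      Submodule.mem_span_singleton.mpr ⟨c, (Algebra.algebraMap_eq_smul_one c).symm⟩⟩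
    · obtain ⟨c, rfl⟩ := Submodule.mem_span_singleton.mp hm
      rw [← Algebra.algebraMap_eq_smul_one, lie_algebraMap_env]
      exact zero_mem (K ∙ (1 : UniversalEnvelopingAlgebra K L))
    · exact inferInstanceAs (FiniteDimensional K (K ∙ (1 : UniversalEnvelopingAlgebra K L)))
  | ι x =>
    let f : L →ₗ⁅K,L⁆ UniversalEnvelopingAlgebra K L :=
      { ((ι K : L →ₗ⁅K⁆ UniversalEnvelopingAlgebra K L) :
          L →ₗ[K] UniversalEnvelopingAlgebra K L) with
        map_lie' := fun {x y} => ι_lie x y }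
    exact ⟨f.range, Module.Finite.range (f : L →ₗ[K] UniversalEnvelopingAlgebra K L),
      (LieModuleHom.mem_range _ _).mpr ⟨x, rfl⟩⟩
  | mul u v hu hv =>
    obtain ⟨N, _, hu⟩ := hu
    obtain ⟨N', _, hv⟩ := hv
    exact LocFin.mul_mem_env hu hv
  | add u v hu hv =>
    obtain ⟨N, _, hu⟩ := hu
    obtain ⟨N', _, hv⟩ := hv
    exact ⟨N ⊔ N', finiteDimensional_sup _ _,
      add_mem (LieSubmodule.mem_sup_left hu) (LieSubmodule.mem_sup_right hv)⟩

theorem locFin_idealEnv [FiniteDimensional K L] (I : LieIdeal K L) : LocFin K L (idealEnv I) :=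
  locFin_env.lieSubmodule (idealEnvLie I)

theorem LocFin.restrict {N : Type*} [AddCommGroup N] [Module K N] [LieRingModule L N]
    [LieModule K L N] (h : LocFin K L N) (g : LieSubalgebra K L) : LocFin K g N := by
  intro n
  obtain ⟨S, hS, hn⟩ := h n
  exact ⟨{ S.toSubmodule with lie_mem := fun {x m} hm => S.lie_mem (x := (x : L)) hm }, hS, hn⟩

end LocallyFiniteEnv

section Generation

open LieModule

variable {R L : Type*} [CommRing R] [LieRing L] [LieAlgebra R L] {I : LieIdeal R L}
  {N : Type*} [AddCommGroup N] [Module R N] [LieRingModule L N] [LieModule R L N]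

variable (I N) in
/-- `N` as a module over the subalgebra of the enveloping algebra generated by `I`. -/
noncomputable abbrev idealEnvModule : Module (idealEnv I) N :=
  Module.compHom N ((act N).comp (idealEnv I).val : idealEnv I →ₐ[R] Module.End R N).toRingHom

theorem idealEnvModule_isScalarTower :
    letI := idealEnvModule I N
    IsScalarTower R (idealEnv I) N :=
  letI := idealEnvModule I N
  ⟨fun c a n => by
    change act N ((c • a : idealEnv I) : UniversalEnvelopingAlgebra R L) n =
      c • act N (a : UniversalEnvelopingAlgebra R L) n
    rw [Subalgebra.coe_smul, map_smul, LinearMap.smul_apply]⟩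

variable (I N) in
/-- `N` is finitely generated over the subalgebra of the enveloping algebra generated by `I`. -/
def IdealFG : Prop :=
  letI := idealEnvModule I N
  Module.Finite (idealEnv I) N

theorem IdealFG.of_lieSpan_eq_top {g : LieSubalgebra R L} (hgI : g.toSubmodule ⊔ I.toSubmodule = ⊤)
    {W : Submodule R N} (hW : W.FG) (hgW : ∀ x ∈ g, ∀ w ∈ W, ⁅x, w⁆ ∈ W)
    (hspan : LieSubmodule.lieSpan R L (W : Set N) = ⊤) : IdealFG I N := by
  let _ := idealEnvModule I N
  have := idealEnvModule_isScalarTower (I := I) (N := N)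
  set T := Submodule.span (idealEnv I) (W : Set N)
  have hWT : ∀ w ∈ W, w ∈ T := fun w hw => Submodule.subset_span hw
  have hlie : ∀ n ∈ T, ∀ x : L, ⁅x, n⁆ ∈ T := by
    intro n hn
    induction hn using Submodule.span_induction with
    | mem w hw =>
      intro x
      obtain ⟨y, hy, z, hz, rfl⟩ := Submodule.mem_sup.mp (hgI ▸ Submodule.mem_top (x := x))
      rw [add_lie, ← act_ι (R := R) z w]
      exact add_mem (hWT _ (hgW y hy w hw)) (T.smul_mem ⟨_, ι_mem_idealEnv hz⟩ (hWT w hw))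
    | zero => intro x; rw [lie_zero]; exact zero_mem T
    | add m n _ _ hm hn => intro x; rw [lie_add]; exact add_mem (hm x) (hn x)
    | smul a n hn ih =>
      intro x
      change ⁅x, act N (a : UniversalEnvelopingAlgebra R L) n⁆ ∈ T
      rw [eq_add_of_sub_eq (act_lie x (a : UniversalEnvelopingAlgebra R L) n).symm]
      exact add_mem (T.smul_mem ⁅x, a⁆ hn) (T.smul_mem a (ih x))
  let T' : LieSubmodule R L N := { T.restrictScalars R with lie_mem := fun hn => hlie _ hn _ }
  have hT : T = ⊤ := eq_top_iff.mpr fun n _ =>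
    (LieSubmodule.lieSpan_le (N := T')).mpr hWT (hspan ▸ LieSubmodule.mem_top n)
  obtain ⟨S, rfl⟩ := hW
  refine ⟨S, eq_top_iff.mpr (hT ▸ Submodule.span_le.mpr ?_)⟩
  exact Submodule.span_le_restrictScalars R (idealEnv I) (S : Set N)

theorem act_hom_apply {E : Type*} [AddCommGroup E] [Module R E] [LieRingModule L E]
    [LieModule R L E] (hE : ∀ x ∈ I, ∀ e : E, ⁅x, e⁆ = 0)
    {a : UniversalEnvelopingAlgebra R L} (ha : a ∈ idealEnv I) :
    ∀ (φ : E →ₗ[R] N) (e : E), act (E →ₗ[R] N) a φ e = act N a (φ e) := by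
  induction ha using Algebra.adjoin_induction with
  | mem y hy =>
    obtain ⟨y, hy, rfl⟩ := hy
    intro φ e
    rw [act_ι, act_ι, LieHom.lie_apply, hE y hy, map_zero, sub_zero]
  | algebraMap r => intro φ e; rw [act_algebraMap, act_algebraMap, LinearMap.smul_apply]
  | add a b _ _ ha hb =>
    intro φ e
    rw [map_add, LinearMap.add_apply, LinearMap.add_apply, ha, hb, map_add, LinearMap.add_apply]
  | mul a b _ _ ha hb => intro φ e; rw [act_mul, act_mul, ha, hb]

theorem act_tmul {E : Type*} [AddCommGroup E] [Module R E] [LieRingModule L E]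
    [LieModule R L E] (hE : ∀ x ∈ I, ∀ e : E, ⁅x, e⁆ = 0)
    {a : UniversalEnvelopingAlgebra R L} (ha : a ∈ idealEnv I) :
    ∀ (n : N) (e : E), act (N ⊗[R] E) a (n ⊗ₜ e) = act N a n ⊗ₜ e := by
  induction ha using Algebra.adjoin_induction with
  | mem y hy =>
    obtain ⟨y, hy, rfl⟩ := hy
    intro n e
    rw [act_ι, act_ι, TensorProduct.LieModule.lie_tmul_right, hE y hy, TensorProduct.tmul_zero,
      add_zero]
  | algebraMap r => intro n e; rw [act_algebraMap, act_algebraMap, TensorProduct.smul_tmul']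
  | add a b _ _ ha hb =>
    intro n e
    rw [map_add, LinearMap.add_apply, ha, hb, map_add, LinearMap.add_apply, TensorProduct.add_tmul]
  | mul a b _ _ ha hb => intro n e; rw [act_mul, act_mul, hb, ha]

theorem IdealFG.hom {E : Type*} [AddCommGroup E] [Module R E] [LieRingModule L E]
    [LieModule R L E] [Module.Free R E] [Module.Finite R E] (h : IdealFG I N)
    (hE : ∀ x ∈ I, ∀ e : E, ⁅x, e⁆ = 0) : IdealFG I (E →ₗ[R] N) := by
  let _ := idealEnvModule I N
  let _ := idealEnvModule I (E →ₗ[R] N)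
  have : Module.Finite (idealEnv I) N := h
  let b := Module.Free.chooseBasis R E
  let F : (Module.Free.ChooseBasisIndex R E → N) →ₗ[idealEnv I] (E →ₗ[R] N) :=
    { toFun := b.constr R
      map_add' := map_add (b.constr R)
      map_smul' := fun a f => b.ext fun i => by
        change _ = act (E →ₗ[R] N) (a : UniversalEnvelopingAlgebra R L) (b.constr R f) (b i)
        rw [act_hom_apply hE a.2, b.constr_basis, b.constr_basis]
        rfl }
  exact Module.Finite.of_surjective F (b.constr R).surjective

section Abelian

variable [IsLieAbelian I]

theorem IdealFG.exists_finset_generating [IsNoetherianRing R] [IsNoetherian R L]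
    (h : IdealFG I N) (T : Set N) :
    ∃ S : Finset N, (S : Set N) ⊆ T ∧ ∀ n ∈ T, ∃ a : N → idealEnv I,
      n = ∑ s ∈ S, act N (a s : UniversalEnvelopingAlgebra R L) s := by
  let _ := idealEnvModule I N
  have : Module.Finite (idealEnv I) N := h
  obtain ⟨S, hST, hS⟩ := (Submodule.fg_span_iff_fg_span_finset_subset T).mp
    (IsNoetherian.noetherian (Submodule.span (idealEnv I) T))
  refine ⟨S, hST, fun n hn => ?_⟩
  have hn' : n ∈ Submodule.span (idealEnv I) (S : Set N) := hS ▸ Submodule.subset_span hn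
  obtain ⟨a, -, ha⟩ := Submodule.mem_span_finset.mp hn'
  exact ⟨a, ha.symm⟩

theorem IdealFG.nakayama (h : IdealFG I N) (J : Ideal (idealEnv I))
    (hJ : ⊤ ≤ Submodule.span R {m : N | ∃ b ∈ J, ∃ k : N,
      m = act N (b : UniversalEnvelopingAlgebra R L) k}) :
    ∃ r : idealEnv I, r - 1 ∈ J ∧ ∀ n : N, act N (r : UniversalEnvelopingAlgebra R L) n = 0 := by
  let _ := idealEnvModule I N
  have hN : (⊤ : Submodule (idealEnv I) N).FG := Module.Finite.fg_top (self := h)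
  obtain ⟨r, hr, hr'⟩ := Submodule.exists_sub_one_mem_and_smul_eq_zero_of_fg_of_le_smul J
    (⊤ : Submodule (idealEnv I) N) hN (by
      intro n _
      have hn := hJ (Submodule.mem_top (x := n))
      induction hn using Submodule.span_induction with
      | mem m hm =>
        obtain ⟨b, hb, k, rfl⟩ := hm
        exact Submodule.smul_mem_smul (r := b) hb (n := k) trivial
      | zero => exact zero_mem _
      | add x y _ _ hx hy => exact add_mem (hx trivial) (hy trivial)
      | smul c x _ hx =>
        rw [← act_algebraMap (L := L)]
        exact Submodule.smul_mem _ (algebraMap R (idealEnv I) c) (hx trivial))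
  exact ⟨r, hr, fun n => hr' n trivial⟩

theorem IdealFG.exists_annihilator (h : IdealFG I N) (hN : IsIrreducible R L N)
    {J : Ideal (idealEnv I)} (hJ : ∀ x : L, ∀ b ∈ J, ⁅x, b⁆ ∈ J) {b : idealEnv I} (hb : b ∈ J)
    {n : N} (hbn : act N (b : UniversalEnvelopingAlgebra R L) n ≠ 0) :
    ∃ r : idealEnv I, r - 1 ∈ J ∧ ∀ n : N, act N (r : UniversalEnvelopingAlgebra R L) n = 0 := by
  let T : LieSubmodule R L N :=
    { Submodule.span R {m : N | ∃ b ∈ J, ∃ k : N,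
        m = act N (b : UniversalEnvelopingAlgebra R L) k} with
      lie_mem := fun {x m} hm => by
        change m ∈ Submodule.span R _ at hm
        change ⁅x, m⁆ ∈ Submodule.span R _
        induction hm using Submodule.span_induction with
        | mem m hm =>
          obtain ⟨b, hb, k, rfl⟩ := hm
          rw [eq_add_of_sub_eq (act_lie x (b : UniversalEnvelopingAlgebra R L) k).symm]
          exact add_mem (Submodule.subset_span ⟨_, hJ x b hb, k, rfl⟩)
            (Submodule.subset_span ⟨b, hb, _, rfl⟩)
        | zero => rw [lie_zero]; exact zero_mem _
        | add m n _ _ hm hn => rw [lie_add]; exact add_mem hm hn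
        | smul c m _ hm => rw [lie_smul]; exact Submodule.smul_mem _ c hm }
  have hT : T = ⊤ := (hN.eq_bot_or_eq_top T).resolve_left fun hbot => hbn <|
    (LieSubmodule.eq_bot_iff T).mp hbot _ (Submodule.subset_span ⟨b, hb, n, rfl⟩)
  exact h.nakayama J (congrArg LieSubmodule.toSubmodule hT).ge

theorem IdealFG.isCoatomic [IsNoetherianRing R] [IsNoetherian R L] (h : IdealFG I N) :
    IsCoatomic (LieSubmodule R L N) := by
  let _ := idealEnvModule I N
  have : Module.Finite (idealEnv I) N := h
  let f : LieSubmodule R L N → Submodule (idealEnv I) N := fun S =>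
    { carrier := S
      add_mem' := S.add_mem'
      zero_mem' := S.zero_mem'
      smul_mem' := fun a n hn => act_mem S (a : UniversalEnvelopingAlgebra R L) n hn }
  have hf : StrictMono f := fun S T hST => hST
  have : WellFoundedGT (LieSubmodule R L N) := hf.wellFoundedGT
  exact isCoatomic_of_orderTop_gt_wellFounded wellFounded_gt

end Abelian

end Generation

section Complement

open LieModule UniversalEnvelopingAlgebra

variable {R L : Type*} [CommRing R] [LieRing L] [LieAlgebra R L] {g : LieSubalgebra R L}
  {I : LieIdeal R L} (h : IsCompl g.toSubmodule I.toSubmodule)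

/-- The projection of `L = g ⋉ I` onto `g` along the ideal `I`. -/
noncomputable def subalgebraProj : L →ₗ⁅R⁆ g :=
  { Submodule.projectionOnto g.toSubmodule I.toSubmodule h with
    map_lie' := fun {x y} => by
      set p := Submodule.projectionOnto g.toSubmodule I.toSubmodule h
      have hdiff : ⁅x, y⁆ - ⁅(p x : L), (p y : L)⁆ ∈ I := by
        have hsplit : ⁅x, y⁆ - ⁅(p x : L), (p y : L)⁆ =
            ⁅x - (p x : L), y⁆ + ⁅(p x : L), y - (p y : L)⁆ := by
          rw [sub_lie, lie_sub]; abel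
        rw [hsplit]
        exact add_mem (lie_mem_left R L I _ _ (Submodule.sub_projection_mem h x))
          (lie_mem_right R L I _ _ (Submodule.sub_projection_mem h y))
      have hp := (Submodule.projectionOnto_apply_eq_zero_iff h).mpr hdiff
      rw [map_sub, sub_eq_zero] at hp
      exact hp.trans (Submodule.projectionOnto_apply_left h ⟨_, g.lie_mem (p x).2 (p y).2⟩) }

theorem subalgebraProj_coe (x : g) : subalgebraProj h x = x :=
  Submodule.projectionOnto_apply_left h x

theorem subalgebraProj_of_mem {x : L} (hx : x ∈ I) : subalgebraProj h x = 0 :=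
  (Submodule.projectionOnto_apply_eq_zero_iff h).mpr hx

theorem coe_subalgebraProj_lie (x y : L) : (subalgebraProj h ⁅x, y⁆ : L) =
    ⁅(subalgebraProj h x : L), (subalgebraProj h y : L)⁆ := by
  rw [LieHom.map_lie, LieSubalgebra.coe_bracket]

/-- The projection of `L = g ⋉ I` onto the ideal `I` along `g`. -/
noncomputable def idealProj : L →ₗ[R] I :=
  Submodule.projectionOnto I.toSubmodule g.toSubmodule h.symm

theorem idealProj_coe (x : g) : idealProj h x = 0 :=
  Submodule.projectionOnto_apply_right h.symm x

theorem idealProj_of_mem {x : L} (hx : x ∈ I) : idealProj h x = ⟨x, hx⟩ :=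
  Submodule.projectionOnto_apply_left h.symm ⟨x, hx⟩

theorem subalgebraProj_add_idealProj (x : L) : (subalgebraProj h x : L) + idealProj h x = x :=
  Submodule.projection_add_projection_eq_self h x

theorem idealProj_lie [IsLieAbelian I] (x y : L) : idealProj h ⁅x, y⁆ =
    ⁅(subalgebraProj h x : L), idealProj h y⁆ - ⁅(subalgebraProj h y : L), idealProj h x⁆ := by
  have habel : ⁅(idealProj h x : L), (idealProj h y : L)⁆ = 0 :=
    congrArg Subtype.val (trivial_lie_zero I I (idealProj h x) (idealProj h y))
  have hlie : ⁅(subalgebraProj h x : L) + idealProj h x, (subalgebraProj h y : L) + idealProj h y⁆ -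
      ⁅(subalgebraProj h x : L), (subalgebraProj h y : L)⁆ =
      ⁅(subalgebraProj h x : L), (idealProj h y : L)⁆ -
        ⁅(subalgebraProj h y : L), (idealProj h x : L)⁆ := by
    rw [← lie_skew (subalgebraProj h y : L)]
    simp only [add_lie, lie_add, habel]
    abel
  rw [subalgebraProj_add_idealProj, subalgebraProj_add_idealProj, ← coe_subalgebraProj_lie] at hlie
  exact Subtype.ext
    ((eq_sub_of_add_eq' (subalgebraProj_add_idealProj h ⁅x, y⁆)).trans hlie)

/-- The `g`-module `E`, considered as a module over `L = g ⋉ I` on which `I` acts by zero. -/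
def Infl (_ : IsCompl g.toSubmodule I.toSubmodule) (E : Type*) : Type _ := E

section Infl

variable (E : Type*) [AddCommGroup E] [LieRingModule g E]

instance : AddCommGroup (Infl h E) := inferInstanceAs (AddCommGroup E)
noncomputable instance : LieRingModule L (Infl h E) :=
  LieRingModule.compLieHom E (subalgebraProj h)

theorem lie_infl_eq_zero {x : L} (hx : x ∈ I) (e : Infl h E) : ⁅x, e⁆ = 0 := by
  change ⁅subalgebraProj h x, (show E from e)⁆ = (0 : E)
  rw [subalgebraProj_of_mem h hx, zero_lie]

variable [Module R E] [LieModule R g E]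

instance : Module R (Infl h E) := inferInstanceAs (Module R E)
instance : LieModule R L (Infl h E) := LieModule.compLieHom E (subalgebraProj h)
instance [Module.Finite R E] : Module.Finite R (Infl h E) := inferInstanceAs (Module.Finite R E)

/-- The identity, as an isomorphism of a `g`-module with the restriction of its inflation. -/
noncomputable def inflEquiv : E ≃ₗ⁅R,g⁆ Infl h E :=
  { LinearEquiv.refl R E with
    map_lie' := fun {x e} => by
      change ⁅x, e⁆ = ⁅subalgebraProj h (x : L), e⁆
      rw [subalgebraProj_coe] }

end Infl

end Complement

section Invariants

open LieModule UniversalEnvelopingAlgebra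

variable {R L : Type*} [CommRing R] [LieRing L] [LieAlgebra R L] {I : LieIdeal R L}

variable (I) in
/-- The orbit map `a ↦ a n` of a `g`-invariant vector `n`. -/
noncomputable def orbit (g : LieSubalgebra R L) {N : Type*} [AddCommGroup N] [Module R N]
    [LieRingModule L N] [LieModule R L N] {n : N} (hn : n ∈ maxTrivSubmodule R g N) :
    idealEnv I →ₗ⁅R,g⁆ N :=
  { ((act N).toLinearMap.flip n) ∘ₗ (idealEnv I).val.toLinearMap with
    map_lie' := fun {x a} => by
      have hxn : ⁅(x : L), n⁆ = 0 := (mem_maxTrivSubmodule R g N n).mp hn x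
      change act N ⁅(x : L), (a : UniversalEnvelopingAlgebra R L)⁆ n =
        ⁅(x : L), act N (a : UniversalEnvelopingAlgebra R L) n⁆
      rw [act_lie, hxn, map_zero, sub_zero] }

variable (I) in
/-- The inclusion of the ideal `I` into the subalgebra of the enveloping algebra it generates. -/
noncomputable def idealι : I →ₗ⁅R,L⁆ idealEnv I where
  toFun x := ⟨ι R (x : L), ι_mem_idealEnv x.2⟩
  map_add' x y := Subtype.ext (map_add (ι R) (x : L) y)
  map_smul' t x := Subtype.ext (map_smul (ι R) t (x : L))
  map_lie' {x y} := Subtype.ext (ι_lie x (y : L))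

theorem lie_one_idealEnv (x : L) : ⁅x, (1 : idealEnv I)⁆ = 0 :=
  Subtype.ext <| by
    change ι R x * (1 : UniversalEnvelopingAlgebra R L) - 1 * ι R x = 0
    rw [mul_one, one_mul, sub_self]

theorem mem_maxTriv_of_mem_center (g : LieSubalgebra R L) {z : idealEnv I}
    (hz : (z : UniversalEnvelopingAlgebra R L) ∈ Subalgebra.center R _) :
    z ∈ maxTrivSubmodule R g (idealEnv I) :=
  (mem_maxTrivSubmodule R g _ _).mpr fun x => Subtype.ext <|
    sub_eq_zero.mpr (Subalgebra.mem_center_iff.mp hz (ι R (x : L)))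

variable [IsLieAbelian I]

theorem lie_idealEnv_eq_zero {x : L} (hx : x ∈ I) (a : idealEnv I) : ⁅x, a⁆ = 0 :=
  Subtype.ext <| sub_eq_zero.mpr <|
    congrArg Subtype.val (mul_comm (⟨ι R x, ι_mem_idealEnv hx⟩ : idealEnv I) a)

theorem mem_center_of_mem_maxTriv {g : LieSubalgebra R L}
    (hgI : g.toSubmodule ⊔ I.toSubmodule = ⊤) {a : idealEnv I}
    (ha : a ∈ maxTrivSubmodule R g (idealEnv I)) :
    (a : UniversalEnvelopingAlgebra R L) ∈ Subalgebra.center R _ := by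
  refine Subalgebra.mem_center_iff.mpr fun u => ?_
  induction u using env_induction with
  | algebraMap c => exact Algebra.commutes c _
  | ι x =>
    obtain ⟨y, hy, z, hz, rfl⟩ := Submodule.mem_sup.mp (hgI ▸ Submodule.mem_top (x := x))
    have hya : ⁅y, a⁆ = 0 := (mem_maxTrivSubmodule R g _ a).mp ha ⟨y, hy⟩
    have hxa : ⁅y + z, a⁆ = 0 := by rw [add_lie, hya, lie_idealEnv_eq_zero hz, add_zero]
    exact sub_eq_zero.mp (congrArg Subtype.val hxa)
  | mul u v hu hv => rw [mul_assoc, hv, ← mul_assoc, hu, mul_assoc]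
  | add u v hu hv => rw [add_mul, mul_add, hu, hv]

end Invariants

section InducedAction

open LieModule UniversalEnvelopingAlgebra

variable {R L : Type*} [CommRing R] [LieRing L] [LieAlgebra R L] {g : LieSubalgebra R L}
  {I : LieIdeal R L} [IsLieAbelian I] (h : IsCompl g.toSubmodule I.toSubmodule)

/-- The action of `L = g ⋉ I` on `U(I) ≃ U(L) / U(L) g`: the subalgebra `g` acts by derivations and
the ideal `I` by multiplication. -/
noncomputable def inducedEnd : L →ₗ[R] Module.End R (idealEnv I) :=
  (toEnd R L (idealEnv I) : L →ₗ[R] Module.End R (idealEnv I)) ∘ₗ g.toSubmodule.subtype ∘ₗ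
    (subalgebraProj h : L →ₗ[R] g) +
  LinearMap.mul R (idealEnv I) ∘ₗ (idealι I).toLinearMap ∘ₗ idealProj h

theorem inducedEnd_apply (x : L) (a : idealEnv I) :
    inducedEnd h x a = ⁅(subalgebraProj h x : L), a⁆ + idealι I (idealProj h x) * a :=
  rfl

theorem inducedEnd_lie (x y : L) (a : idealEnv I) : inducedEnd h ⁅x, y⁆ a =
    inducedEnd h x (inducedEnd h y a) - inducedEnd h y (inducedEnd h x a) := by
  simp only [inducedEnd_apply, coe_subalgebraProj_lie, idealProj_lie, map_sub,
    LieModuleHom.map_lie, lie_add, lie_mul_idealEnv, lie_lie]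
  ring

theorem inducedEnd_coe_one (x : g) : inducedEnd h (x : L) 1 = 0 := by
  rw [inducedEnd_apply, idealProj_coe, map_zero, zero_mul, lie_one_idealEnv, add_zero]

attribute [local instance] LieRing.ofAssociativeRing in
/-- The action of `U(L)` on `U(I) ≃ U(L) / U(L) g`. -/
noncomputable def inducedAct :
    UniversalEnvelopingAlgebra R L →ₐ[R] Module.End R (idealEnv I) :=
  lift R
    { toLinearMap := inducedEnd h
      map_lie' := fun {x y} => LinearMap.ext fun a => inducedEnd_lie h x y a }

theorem inducedAct_ι (x : L) : inducedAct h (ι R x) = inducedEnd h x :=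
  lift_ι_apply ..

theorem inducedAct_coe (a b : idealEnv I) : inducedAct h a b = a * b := by
  obtain ⟨a, ha⟩ := a
  change inducedAct h a b = _
  induction ha using Algebra.adjoin_induction generalizing b with
  | mem y hy =>
    obtain ⟨y, hy, rfl⟩ := hy
    rw [inducedAct_ι, inducedEnd_apply, subalgebraProj_of_mem h hy, idealProj_of_mem h hy,
      ZeroMemClass.coe_zero, zero_lie, zero_add]
    rfl
  | algebraMap r =>
    rw [AlgHom.commutes, Module.algebraMap_end_apply]
    exact Algebra.smul_def r b
  | add a a' ha ha' iha iha' =>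
    rw [map_add, LinearMap.add_apply, iha, iha']
    exact (add_mul (⟨a, ha⟩ : idealEnv I) ⟨a', ha'⟩ b).symm
  | mul a a' ha ha' iha iha' =>
    rw [map_mul, Module.End.mul_apply, iha', iha]
    exact (mul_assoc (⟨a, ha⟩ : idealEnv I) ⟨a', ha'⟩ b).symm

end InducedAction

section RadicalCenter

open LieModule UniversalEnvelopingAlgebra

variable {𝔏 : Type u} [LieRing 𝔏] [LieAlgebra ℂ 𝔏] {g : LieSubalgebra ℂ 𝔏}

theorem IsLevi.isKilling [FiniteDimensional ℂ 𝔏] (hg : IsLevi g) : LieAlgebra.IsKilling ℂ g := by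
  have := hg.semisimple
  infer_instance

variable (𝔏) in
/-- The subalgebra `U(r)` of `U(𝔏)`, where `r` is the radical of `𝔏`. -/
noncomputable abbrev radAlg : Subalgebra ℂ (Env 𝔏) := idealEnv (LieAlgebra.radical ℂ 𝔏)

theorem locFin_radAlg [FiniteDimensional ℂ 𝔏] : LocFin ℂ g (radAlg 𝔏) :=
  (locFin_idealEnv _).restrict g

/-- A radical central element as an element of `U(r)`. -/
noncomputable def toRadAlg : radicalCenter 𝔏 →ₐ[ℂ] radAlg 𝔏 :=
  Subalgebra.inclusion inf_le_right

theorem toRadAlg_injective : Function.Injective (toRadAlg (𝔏 := 𝔏)) :=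
  Subalgebra.inclusion_injective _

theorem toRadAlg_mem_maxTriv (z : radicalCenter 𝔏) :
    toRadAlg z ∈ maxTrivSubmodule ℂ g (radAlg 𝔏) :=
  mem_maxTriv_of_mem_center g z.2.1

theorem radicalCenter_mul_comm (z : radicalCenter 𝔏) (u : Env 𝔏) : (z : Env 𝔏) * u = u * z :=
  (Subalgebra.mem_center_iff.mp (show (z : Env 𝔏) ∈ Subalgebra.center ℂ _ from z.2.1) u).symm

variable [IsLieAbelian (LieAlgebra.radical ℂ 𝔏)] [FiniteDimensional ℂ 𝔏]
  [LieAlgebra.IsKilling ℂ g]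

/-- The projection `a ↦ a^g` of `U(r)` onto its `g`-invariants, which are central in `U(𝔏)`. -/
noncomputable def centralReynolds (hg : IsLevi g) : radAlg 𝔏 →ₗ[ℂ] radicalCenter 𝔏 where
  toFun a :=
    ⟨locFin_radAlg.reynolds a,
      mem_center_of_mem_maxTriv hg.isCompl.sup_eq_top (locFin_radAlg (g := g).reynolds_mem a),
      (locFin_radAlg (g := g).reynolds a).2⟩
  map_add' a b := toRadAlg_injective (map_add (locFin_radAlg (g := g).reynolds) a b)
  map_smul' c a := toRadAlg_injective (map_smul (locFin_radAlg (g := g).reynolds) c a)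

theorem centralReynolds_toRadAlg (hg : IsLevi g) (z : radicalCenter 𝔏) :
    centralReynolds hg (toRadAlg z) = z :=
  toRadAlg_injective (locFin_radAlg.reynolds_eq (toRadAlg_mem_maxTriv z))

theorem centralReynolds_mul (hg : IsLevi g) (z : radicalCenter 𝔏) (a : radAlg 𝔏) :
    centralReynolds hg (toRadAlg z * a) = z * centralReynolds hg a := by
  let f : radAlg 𝔏 →ₗ⁅ℂ,g⁆ radAlg 𝔏 :=
    { LinearMap.mulLeft ℂ (toRadAlg z) with
      map_lie' := fun {x a} => by
        have hz : ⁅(x : 𝔏), toRadAlg z⁆ = 0 :=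
          (mem_maxTrivSubmodule ℂ g _ _).mp (toRadAlg_mem_maxTriv z) x
        change toRadAlg z * ⁅(x : 𝔏), a⁆ = ⁅(x : 𝔏), toRadAlg z * a⁆
        rw [lie_mul_idealEnv, hz, zero_mul, zero_add] }
  exact toRadAlg_injective (locFin_radAlg.map_reynolds locFin_radAlg f a).symm

section Character

variable (hg : IsLevi g) {χ : radicalCenter 𝔏 →ₐ[ℂ] ℂ} {N : Type u} [AddCommGroup N] [Module ℂ N]
  [LieRingModule 𝔏 N] [LieModule ℂ 𝔏 N]
include hg

theorem reynolds_act (hN : LocFin ℂ g N) (hχ : HasRadicalCharacter χ N) {n : N}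
    (hn : n ∈ maxTrivSubmodule ℂ g N) (a : radAlg 𝔏) :
    hN.reynolds (act N (a : Env 𝔏) n) = χ (centralReynolds hg a) • n :=
  (locFin_radAlg.map_reynolds hN (orbit _ g hn) a).symm.trans (hχ (centralReynolds hg a) n)

theorem finiteDimensional_maxTriv (hN : LocFin ℂ g N) (hχ : HasRadicalCharacter χ N)
    (hfg : IdealFG (LieAlgebra.radical ℂ 𝔏) N) :
    FiniteDimensional ℂ (maxTrivSubmodule ℂ g N) := by
  obtain ⟨S, hST, hS⟩ := hfg.exists_finset_generating (maxTrivSubmodule ℂ g N : Set N)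
  refine Submodule.finiteDimensional_of_le (S₁ := (maxTrivSubmodule ℂ g N).toSubmodule)
    (S₂ := Submodule.span ℂ (S : Set N)) fun n hn => ?_
  obtain ⟨a, ha⟩ := hS n hn
  rw [← hN.reynolds_eq hn, ha, map_sum]
  refine sum_mem fun s hs => ?_
  rw [reynolds_act hg hN hχ (hST hs)]
  exact Submodule.smul_mem _ _ (Submodule.subset_span hs)

theorem finiteDimensional_hom (hN : LocFin ℂ g N) (hχ : HasRadicalCharacter χ N)
    (hfg : IdealFG (LieAlgebra.radical ℂ 𝔏) N) (M : Type u) [AddCommGroup M] [Module ℂ M]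
    [LieRingModule g M] [LieModule ℂ g M] [FiniteDimensional ℂ M] :
    FiniteDimensional ℂ (M →ₗ⁅ℂ,g⁆ N) := by
  have hE : ∀ x ∈ LieAlgebra.radical ℂ 𝔏, ∀ e : Infl hg.isCompl M, ⁅x, e⁆ = 0 :=
    fun x hx e => lie_infl_eq_zero hg.isCompl M hx e
  have hχ' : HasRadicalCharacter χ (Infl hg.isCompl M →ₗ[ℂ] N) := fun z φ =>
    LinearMap.ext fun e => (act_hom_apply hE z.2.2 φ e).trans (hχ z (φ e))
  have := finiteDimensional_maxTriv hg hN.hom hχ' (hfg.hom hE)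
  let f : (M →ₗ⁅ℂ,g⁆ N) →ₗ[ℂ] maxTrivSubmodule ℂ g (Infl hg.isCompl M →ₗ[ℂ] N) :=
    { toFun := fun φ => maxTrivLinearMapEquivLieModuleHom.symm
        (φ.comp (inflEquiv hg.isCompl M).symm.toLieModuleHom)
      map_add' := fun φ ψ => rfl
      map_smul' := fun c φ => rfl }
  refine Module.Finite.of_injective f fun φ ψ hφψ => LieModuleHom.ext fun m => ?_
  exact LieModuleHom.congr_fun (maxTrivLinearMapEquivLieModuleHom.symm.injective hφψ)
    (inflEquiv hg.isCompl M m)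

end Character

end RadicalCenter

section UniversalModule

open LieModule UniversalEnvelopingAlgebra

variable {𝔏 : Type u} [LieRing 𝔏] [LieAlgebra ℂ 𝔏] (g : LieSubalgebra ℂ 𝔏)
  (χ : radicalCenter 𝔏 →ₐ[ℂ] ℂ)

/-- The projection `U(𝔏) → Q(0, χ)`. -/
noncomputable def toQ : Env 𝔏 →ₗ[Env 𝔏] Q₀χ g χ :=
  (charSubmodule g χ).mkQ ∘ₗ (leftIdeal g).mkQ

theorem toQ_surjective : Function.Surjective (toQ g χ) :=
  (Submodule.mkQ_surjective _).comp (Submodule.mkQ_surjective _)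

variable {g χ}

theorem toQ_complex_smul (c : ℂ) (u : Env 𝔏) : toQ g χ (c • u) = c • toQ g χ u := by
  rw [← algebraMap_smul (Env 𝔏) c u, map_smul, algebraMap_smul]

theorem ι_mem_leftIdeal (x : g) : (ι ℂ (x : 𝔏) : Env 𝔏) ∈ leftIdeal g :=
  Submodule.subset_span ⟨x, x.2, rfl⟩

theorem toQ_eq_zero_of_mem {u : Env 𝔏} (hu : u ∈ leftIdeal g) : toQ g χ u = 0 := by
  have h0 : (leftIdeal g).mkQ u = 0 := (Submodule.Quotient.mk_eq_zero _).mpr hu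
  rw [toQ, LinearMap.comp_apply, h0, map_zero]

theorem toQ_radicalCenter (z : radicalCenter 𝔏) : toQ g χ z = χ z • toQ g χ 1 := by
  rw [← toQ_complex_smul, ← sub_eq_zero, ← map_sub, ← Algebra.algebraMap_eq_smul_one]
  refine (Submodule.Quotient.mk_eq_zero _).mpr (Submodule.subset_span
    ⟨z - algebraMap ℂ _ (χ z), by rw [map_sub, AlgHom.commutes, Algebra.algebraMap_self_apply,
      sub_self], (leftIdeal g).mkQ 1, ?_⟩)
  rw [← map_smul, smul_eq_mul, mul_one]
  rfl

theorem ker_toQ_le {K : Submodule (Env 𝔏) (Env 𝔏)} (hg : ∀ x : g, (ι ℂ (x : 𝔏) : Env 𝔏) ∈ K)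
    (hχ : ∀ z : radicalCenter 𝔏, χ z = 0 → (z : Env 𝔏) ∈ K) : LinearMap.ker (toQ g χ) ≤ K := by
  intro u hu
  have hl : leftIdeal g ≤ K := Submodule.span_le.mpr <| by
    rintro _ ⟨x, hx, rfl⟩
    exact hg ⟨x, hx⟩
  have hc : charSubmodule g χ ≤ K.map (leftIdeal g).mkQ := Submodule.span_le.mpr <| by
    rintro _ ⟨z, hz, p, rfl⟩
    obtain ⟨v, rfl⟩ := Submodule.mkQ_surjective _ p
    refine ⟨(z : Env 𝔏) * v, ?_, rfl⟩
    rw [radicalCenter_mul_comm]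
    exact K.smul_mem v (hχ z hz)
  obtain ⟨k, hk, hku⟩ := hc ((Submodule.Quotient.mk_eq_zero _).mp hu)
  exact (Submodule.sub_mem_iff_left K hk).mp (hl ((Submodule.Quotient.eq _).mp hku.symm))

/-- The preimage in `U(r)` of a submodule of `Q(0, χ)`. -/
noncomputable def radIdeal [IsLieAbelian (LieAlgebra.radical ℂ 𝔏)]
    (N : Submodule (Env 𝔏) (Q₀χ g χ)) : Ideal (radAlg 𝔏) where
  carrier := {b | toQ g χ (b : Env 𝔏) ∈ N}
  add_mem' {b c} hb hc := by
    change toQ g χ ((b : Env 𝔏) + c) ∈ N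
    rw [map_add]
    exact add_mem hb hc
  zero_mem' := by
    change toQ g χ 0 ∈ N
    rw [map_zero]
    exact zero_mem N
  smul_mem' c {b} hb := by
    change toQ g χ ((c : Env 𝔏) • (b : Env 𝔏)) ∈ N
    rw [map_smul]
    exact N.smul_mem _ hb

variable [IsLieAbelian (LieAlgebra.radical ℂ 𝔏)]

theorem mem_radIdeal {N : Submodule (Env 𝔏) (Q₀χ g χ)} {b : radAlg 𝔏} :
    b ∈ radIdeal N ↔ toQ g χ (b : Env 𝔏) ∈ N :=
  Iff.rfl

theorem lie_mem_radIdeal (hg : IsLevi g) (N : Submodule (Env 𝔏) (Q₀χ g χ)) (x : 𝔏) {b : radAlg 𝔏}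
    (hb : b ∈ radIdeal N) : ⁅x, b⁆ ∈ radIdeal N := by
  have hx : ⁅x, b⁆ = ⁅(subalgebraProj hg.isCompl x : 𝔏), b⁆ := by
    conv_lhs => rw [← subalgebraProj_add_idealProj hg.isCompl x]
    rw [add_lie, lie_idealEnv_eq_zero (SetLike.coe_mem _), add_zero]
  have hbx : toQ g χ ((b : Env 𝔏) * ι ℂ (subalgebraProj hg.isCompl x : 𝔏)) = 0 :=
    toQ_eq_zero_of_mem ((leftIdeal g).smul_mem (b : Env 𝔏) (ι_mem_leftIdeal _))
  rw [hx, mem_radIdeal, coe_lie_idealEnv, map_sub, hbx, sub_zero, ← smul_eq_mul, map_smul]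
  exact N.smul_mem _ hb

theorem mul_sub_inducedAct_mem_leftIdeal (hg : IsLevi g) (u : Env 𝔏) (a : radAlg 𝔏) :
    u * a - inducedAct hg.isCompl u a ∈ leftIdeal g := by
  induction u using env_induction generalizing a with
  | algebraMap c =>
    rw [AlgHom.commutes, Module.algebraMap_end_apply, Subalgebra.coe_smul, Algebra.smul_def,
      sub_self]
    exact zero_mem _
  | ι x =>
    have hx : ι ℂ x * (a : Env 𝔏) - inducedAct hg.isCompl (ι ℂ x) a =
        (a : Env 𝔏) * ι ℂ (subalgebraProj hg.isCompl x : 𝔏) := by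
      conv_lhs => enter [1]; rw [← subalgebraProj_add_idealProj hg.isCompl x]
      rw [inducedAct_ι, inducedEnd_apply, Subalgebra.coe_add, coe_lie_idealEnv, map_add]
      change _ - (_ + ι ℂ (idealProj hg.isCompl x : 𝔏) * (a : Env 𝔏)) = _
      noncomm_ring
    rw [hx]
    exact (leftIdeal g).smul_mem (a : Env 𝔏) (ι_mem_leftIdeal _)
  | mul u v hu hv =>
    have huv := add_mem ((leftIdeal g).smul_mem u (hv a)) (hu (inducedAct hg.isCompl v a))
    rwa [smul_eq_mul, mul_sub, sub_add_sub_cancel, ← mul_assoc, ← Module.End.mul_apply,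
      ← map_mul] at huv
  | add u v hu hv =>
    rw [add_mul, map_add, LinearMap.add_apply, Subalgebra.coe_add, add_sub_add_comm]
    exact add_mem (hu a) (hv a)

theorem toQ_inducedAct_one (hg : IsLevi g) (u : Env 𝔏) :
    toQ g χ (inducedAct hg.isCompl u 1 : radAlg 𝔏) = toQ g χ u := by
  have hu := toQ_eq_zero_of_mem (χ := χ) (mul_sub_inducedAct_mem_leftIdeal hg u 1)
  rw [Subalgebra.coe_one, mul_one, map_sub, sub_eq_zero] at hu
  exact hu.symm

variable [FiniteDimensional ℂ 𝔏] [LieAlgebra.IsKilling ℂ g]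

theorem character_centralReynolds_eq_zero (hg : IsLevi g) {N : Submodule (Env 𝔏) (Q₀χ g χ)}
    (hN : N ≠ ⊤) {a : radAlg 𝔏} (ha : a ∈ radIdeal N) : χ (centralReynolds hg a) = 0 := by
  by_contra hne
  let J : LieSubmodule ℂ g (radAlg 𝔏) :=
    { (radIdeal N).restrictScalars ℂ with
      lie_mem := fun {x b} hb => lie_mem_radIdeal hg N (x : 𝔏) hb }
  have hmem : toQ g χ (centralReynolds hg a) ∈ N := locFin_radAlg.reynolds_mem_of_mem J ha
  have hone : toQ g χ 1 ∈ N := by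
    rw [toQ_radicalCenter, ← algebraMap_smul (Env 𝔏)] at hmem
    have hinv := N.smul_mem (algebraMap ℂ (Env 𝔏) (χ (centralReynolds hg a))⁻¹) hmem
    rwa [← mul_smul, ← map_mul, inv_mul_cancel₀ hne, map_one, one_smul] at hinv
  refine hN (eq_top_iff.mpr fun p _ => ?_)
  obtain ⟨v, rfl⟩ := toQ_surjective g χ p
  rw [← mul_one v, ← smul_eq_mul, map_smul]
  exact N.smul_mem v hone

variable (χ) in
/-- The left ideal of all `u` such that `χ` vanishes on the `g`-invariant parts of all elements of
`U(𝔏) u · 1 ⊆ U(r)`. It is the preimage of the maximal submodule of `Q(0, χ)`. -/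
noncomputable def augmentationIdeal (hg : IsLevi g) : Submodule (Env 𝔏) (Env 𝔏) where
  carrier := {u | ∀ v, χ (centralReynolds hg (inducedAct hg.isCompl (v * u) 1)) = 0}
  add_mem' {a b} ha hb v := by
    rw [mul_add, map_add, LinearMap.add_apply, map_add, map_add, ha v, hb v, add_zero]
  zero_mem' v := by rw [mul_zero, map_zero, LinearMap.zero_apply, map_zero, map_zero]
  smul_mem' c {a} ha v := by rw [smul_eq_mul, ← mul_assoc]; exact ha _

theorem one_notMem_augmentationIdeal (hg : IsLevi g) : 1 ∉ augmentationIdeal χ hg := by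
  intro h
  have hone : centralReynolds hg (toRadAlg 1) = 1 := centralReynolds_toRadAlg hg 1
  have h1 := h 1
  rw [mul_one, map_one (inducedAct hg.isCompl), Module.End.one_apply,
    ← map_one (toRadAlg (𝔏 := 𝔏)), hone, map_one] at h1
  exact one_ne_zero h1

theorem ker_toQ_le_augmentationIdeal (hg : IsLevi g) :
    LinearMap.ker (toQ g χ) ≤ augmentationIdeal χ hg := by
  refine ker_toQ_le (fun x v => ?_) (fun z hz v => ?_)
  · rw [map_mul, Module.End.mul_apply, inducedAct_ι, inducedEnd_coe_one, map_zero, map_zero,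
      map_zero]
  · rw [← radicalCenter_mul_comm, map_mul, Module.End.mul_apply,
      show (z : Env 𝔏) = (toRadAlg z : radAlg 𝔏) from rfl, inducedAct_coe, centralReynolds_mul,
      map_mul, hz, zero_mul]

theorem maxSubmodule_le_map_augmentationIdeal (hg : IsLevi g) :
    maxSubmodule g χ ≤ (augmentationIdeal χ hg).map (toQ g χ) := by
  refine sSup_le fun N hN q hq => ?_
  obtain ⟨u, rfl⟩ := toQ_surjective g χ q
  refine ⟨u, fun v => character_centralReynolds_eq_zero hg hN ?_, rfl⟩
  rw [mem_radIdeal, toQ_inducedAct_one hg, ← smul_eq_mul, map_smul]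
  exact N.smul_mem v hq

theorem toQ_one_notMem_maxSubmodule (hg : IsLevi g) : toQ g χ 1 ∉ maxSubmodule g χ := by
  intro h
  obtain ⟨u, hu, hu1⟩ := maxSubmodule_le_map_augmentationIdeal hg h
  have hker : 1 - u ∈ augmentationIdeal χ hg :=
    ker_toQ_le_augmentationIdeal hg (by rw [LinearMap.mem_ker, map_sub, hu1, sub_self])
  exact one_notMem_augmentationIdeal hg ((Submodule.sub_mem_iff_left _ hu).mp hker)

end UniversalModule

section SphericalModule

open LieModule UniversalEnvelopingAlgebra

variable {𝔏 : Type u} [LieRing 𝔏] [LieAlgebra ℂ 𝔏] (g : LieSubalgebra ℂ 𝔏)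
  (χ : radicalCenter 𝔏 →ₐ[ℂ] ℂ)

/-- The projection `U(𝔏) → V(0, χ)`. -/
noncomputable def toV : Env 𝔏 →ₗ[Env 𝔏] V₀ g χ := (maxSubmodule g χ).mkQ ∘ₗ toQ g χ

theorem toV_surjective : Function.Surjective (toV g χ) :=
  (Submodule.mkQ_surjective _).comp (toQ_surjective g χ)

variable {g χ}

theorem toV_eq_zero {u : Env 𝔏} : toV g χ u = 0 ↔ toQ g χ u ∈ maxSubmodule g χ :=
  Submodule.Quotient.mk_eq_zero _

theorem toV_complex_smul (c : ℂ) (u : Env 𝔏) : toV g χ (c • u) = c • toV g χ u := by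
  rw [← algebraMap_smul (Env 𝔏) c u, map_smul, algebraMap_smul]

theorem act_toV (u v : Env 𝔏) : act (V₀ g χ) u (toV g χ v) = toV g χ (u * v) := by
  induction u using env_induction generalizing v with
  | algebraMap c => rw [act_algebraMap, ← Algebra.smul_def, toV_complex_smul]
  | ι x => rw [act_ι, ← smul_eq_mul, map_smul]; rfl
  | mul u u' hu hu' => rw [act_mul, hu', hu, mul_assoc]
  | add u u' hu hu' => rw [map_add, LinearMap.add_apply, hu, hu', add_mul, map_add]

theorem lie_toV (x : 𝔏) (v : Env 𝔏) : ⁅x, toV g χ v⁆ = toV g χ (ι ℂ x * v) := by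
  rw [← act_ι (R := ℂ), act_toV]

variable (g χ) in
theorem hasRadicalCharacter_V₀ : HasRadicalCharacter χ (V₀ g χ) := by
  intro z v
  obtain ⟨u, rfl⟩ := toV_surjective g χ v
  have hz : toV g χ z = χ z • toV g χ 1 := by
    rw [← toV_complex_smul, ← sub_eq_zero, ← map_sub, toV_eq_zero, map_sub, toQ_radicalCenter,
      toQ_complex_smul, sub_self]
    exact zero_mem _
  refine (act_toV (z : Env 𝔏) u).trans ?_
  rw [radicalCenter_mul_comm, ← smul_eq_mul, map_smul, hz, smul_comm, ← map_smul, smul_eq_mul,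
    mul_one]

theorem toV_one_mem_maxTriv : toV g χ 1 ∈ maxTrivSubmodule ℂ g (V₀ g χ) :=
  (mem_maxTrivSubmodule ℂ g _ _).mpr fun x => by
    change ⁅(x : 𝔏), toV g χ 1⁆ = 0
    rw [lie_toV, mul_one, toV_eq_zero, toQ_eq_zero_of_mem (ι_mem_leftIdeal x)]
    exact zero_mem _

theorem exists_hom_V₀ {N : Type*} [AddCommGroup N] [Module ℂ N] [LieRingModule 𝔏 N]
    [LieModule ℂ 𝔏 N] (n : N) (hn : ∀ u, toV g χ u = 0 → act N u n = 0) :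
    ∃ F : V₀ g χ →ₗ⁅ℂ,𝔏⁆ N, ∀ u, F (toV g χ u) = act N u n := by
  let T : Env 𝔏 →ₗ[ℂ] V₀ g χ :=
    { toFun := toV g χ
      map_add' := map_add _
      map_smul' := toV_complex_smul }
  obtain ⟨σ, hσ⟩ := T.exists_rightInverse_of_surjective
    (LinearMap.range_eq_top.mpr (toV_surjective g χ))
  have key (u : Env 𝔏) : act N (σ (toV g χ u)) n = act N u n := by
    rw [← sub_eq_zero, ← LinearMap.sub_apply, ← map_sub]
    refine hn _ ?_
    rw [map_sub, sub_eq_zero]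
    exact LinearMap.congr_fun hσ (toV g χ u)
  refine ⟨{ (act N).toLinearMap.flip n ∘ₗ σ with map_lie' := fun {x v} => ?_ }, key⟩
  change act N (σ ⁅x, v⁆) n = ⁅x, act N (σ v) n⁆
  obtain ⟨u, rfl⟩ := toV_surjective g χ v
  rw [lie_toV, key, key, act_mul, act_ι]

variable [IsLieAbelian (LieAlgebra.radical ℂ 𝔏)]

theorem exists_act_toV_one_eq (hg : IsLevi g) (v : V₀ g χ) :
    ∃ a : radAlg 𝔏, act (V₀ g χ) (a : Env 𝔏) (toV g χ 1) = v := by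
  obtain ⟨u, rfl⟩ := toV_surjective g χ v
  refine ⟨inducedAct hg.isCompl u 1, ?_⟩
  rw [act_toV, mul_one]
  exact congrArg (maxSubmodule g χ).mkQ (toQ_inducedAct_one hg u)

theorem idealFG_V₀ (hg : IsLevi g) : IdealFG (LieAlgebra.radical ℂ 𝔏) (V₀ g χ) := by
  let _ := idealEnvModule (LieAlgebra.radical ℂ 𝔏) (V₀ g χ)
  refine ⟨{toV g χ 1}, eq_top_iff.mpr fun v _ => ?_⟩
  rw [Finset.coe_singleton]
  exact Submodule.mem_span_singleton.mpr (exists_act_toV_one_eq hg v)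

variable [FiniteDimensional ℂ 𝔏]

theorem locFin_V₀ (hg : IsLevi g) : LocFin ℂ g (V₀ g χ) :=
  locFin_radAlg.of_surjective (orbit _ g toV_one_mem_maxTriv) (exists_act_toV_one_eq hg)

variable [LieAlgebra.IsKilling ℂ g]

theorem nontrivial_V₀ (hg : IsLevi g) : Nontrivial (V₀ g χ) :=
  ⟨toV g χ 1, 0, fun h => toQ_one_notMem_maxSubmodule hg (toV_eq_zero.mp h)⟩

section InvariantHom

variable (hg : IsLevi g) {E V : Type u} [AddCommGroup E] [Module ℂ E] [LieRingModule 𝔏 E]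
  [LieModule ℂ 𝔏 E] [AddCommGroup V] [Module ℂ V] [LieRingModule 𝔏 V] [LieModule ℂ 𝔏 V]
  (hE : ∀ x ∈ LieAlgebra.radical ℂ 𝔏, ∀ e : E, ⁅x, e⁆ = 0)
include hg

theorem eq_top_of_sub_one_mem_radIdeal {K : Submodule (Env 𝔏) (Env 𝔏)}
    (hK : LinearMap.ker (toQ g χ) ≤ K) {r : radAlg 𝔏} (hr : r - 1 ∈ radIdeal (maxSubmodule g χ))
    (hrK : (r : Env 𝔏) ∈ K) : K = ⊤ := by
  by_contra hne
  have hmap : K.map (toQ g χ) ≠ ⊤ := fun htop => hne <| by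
    rw [← sup_eq_left.mpr hK, ← Submodule.comap_map_eq, htop, Submodule.comap_top]
  have hrmax : toQ g χ (r : Env 𝔏) ∈ maxSubmodule g χ :=
    le_sSup (show K.map (toQ g χ) ∈ {N | N ≠ ⊤} from hmap) ⟨r, hrK, rfl⟩
  have hone := sub_mem hrmax (mem_radIdeal.mp hr)
  rw [← map_sub, Subalgebra.coe_sub, sub_sub_cancel] at hone
  exact toQ_one_notMem_maxSubmodule hg hone

include hE

theorem ker_toV_le_leftAnnihilator (hV : IsIrreducible ℂ 𝔏 V)
    (hfg : IdealFG (LieAlgebra.radical ℂ 𝔏) V) (hχ : HasRadicalCharacter χ V)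
    {φ : E →ₗ[ℂ] V} (hφ : φ ∈ maxTrivSubmodule ℂ g (E →ₗ[ℂ] V)) :
    LinearMap.ker (toV g χ) ≤ leftAnnihilator φ := by
  have hrad (a : radAlg 𝔏) (ha : ∀ v, act V (a : Env 𝔏) v = 0) :
      (a : Env 𝔏) ∈ leftAnnihilator φ :=
    LinearMap.ext fun e => (act_hom_apply hE a.2 φ e).trans (ha (φ e))
  have hker : LinearMap.ker (toQ g χ) ≤ leftAnnihilator φ := by
    refine ker_toQ_le (fun x => ?_) (fun z hz => hrad (toRadAlg z) fun v => ?_)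
    · exact (act_ι (x : 𝔏) φ).trans ((mem_maxTrivSubmodule ℂ g _ φ).mp hφ x)
    · exact (hχ z v).trans (by rw [hz, zero_smul])
  intro u hu
  set a := inducedAct hg.isCompl u 1
  have hua : toQ g χ (a : Env 𝔏) = toQ g χ u := toQ_inducedAct_one hg u
  have ha : a ∈ radIdeal (maxSubmodule g χ) := by
    rw [mem_radIdeal, hua]
    exact toV_eq_zero.mp hu
  suffices haφ : (a : Env 𝔏) ∈ leftAnnihilator φ from
    (Submodule.sub_mem_iff_left _ haφ).mp (hker (by rw [LinearMap.mem_ker, map_sub, hua, sub_self]))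
  by_contra haφ
  obtain ⟨v, hv⟩ : ∃ v, act V (a : Env 𝔏) v ≠ 0 := by
    by_contra! h
    exact haφ (hrad a h)
  obtain ⟨r, hr, hrV⟩ := hfg.exists_annihilator hV (fun x b hb => lie_mem_radIdeal hg _ x hb) ha hv
  rw [eq_top_of_sub_one_mem_radIdeal hg hker hr (hrad r hrV)] at haφ
  exact haφ Submodule.mem_top

end InvariantHom

end SphericalModule

section Multiplicity

open LieModule Module

section Adjunction

variable {R L M N P P' : Type*} [CommRing R] [LieRing L] [LieAlgebra R L]
  [AddCommGroup M] [Module R M] [LieRingModule L M] [LieModule R L M]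
  [AddCommGroup N] [Module R N] [LieRingModule L N] [LieModule R L N]
  [AddCommGroup P] [Module R P] [LieRingModule L P] [LieModule R L P]
  [AddCommGroup P'] [Module R P'] [LieRingModule L P'] [LieModule R L P']

variable (M) in
/-- Postcomposition with an equivalence of Lie modules. -/
def homCongrRight (e : P ≃ₗ⁅R,L⁆ P') : (M →ₗ⁅R,L⁆ P) ≃ₗ[R] (M →ₗ⁅R,L⁆ P') where
  toFun f := (e : P →ₗ⁅R,L⁆ P').comp f
  invFun f := (e.symm : P' →ₗ⁅R,L⁆ P).comp f
  map_add' f f' := LieModuleHom.ext fun m => map_add e.toLinearEquiv (f m) (f' m)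
  map_smul' c f := LieModuleHom.ext fun m => map_smul e.toLinearEquiv c (f m)
  left_inv f := LieModuleHom.ext fun m => e.symm_apply_apply (f m)
  right_inv f := LieModuleHom.ext fun m => e.apply_symm_apply (f m)

variable (R L N P) in
/-- The equivalence `P ⊗ N ≃ Hom(N*, P)` for a free module `N` of finite rank. -/
noncomputable def tensorEquivDualHom [Module.Free R N] [Module.Finite R N] :
    P ⊗[R] N ≃ₗ⁅R,L⁆ (Dual R N →ₗ[R] P) :=
  let e : P ⊗[R] N ≃ₗ[R] (Dual R N →ₗ[R] P) :=
    TensorProduct.comm R P N ≪≫ₗ TensorProduct.congr (evalEquiv R N) (LinearEquiv.refl R P) ≪≫ₗ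
      dualTensorHomEquiv R (Dual R N) P
  { e with
    map_lie' := fun {x t} => by
      change e ⁅x, t⁆ = ⁅x, e t⁆
      have he (p : P) (n : N) (ξ : Dual R N) : e (p ⊗ₜ n) ξ = ξ n • p := by simp [e]
      induction t using TensorProduct.induction_on with
      | zero => simp
      | add s t hs ht => rw [lie_add, map_add, hs, ht, map_add, lie_add]
      | tmul p n =>
        ext ξ
        rw [TensorProduct.LieModule.lie_tmul_right, map_add, LinearMap.add_apply, he, he,
          LieHom.lie_apply, he, he, lie_smul, Dual.lie_apply, neg_smul, sub_neg_eq_add] }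

variable (M N P) in
/-- The adjunction `Hom(M, P ⊗ N) ≃ Hom(M ⊗ N*, P)`. -/
noncomputable def homTensorEquiv [Module.Free R N] [Module.Finite R N] :
    (M →ₗ⁅R,L⁆ P ⊗[R] N) ≃ₗ[R] (M ⊗[R] Dual R N →ₗ⁅R,L⁆ P) :=
  homCongrRight M (tensorEquivDualHom R L N P) ≪≫ₗ
    TensorProduct.LieModule.liftLie R L M (Dual R N) P

end Adjunction

section Counting

theorem linearIndependent_of_separating {K ι P : Type*} [Field K] [AddCommGroup P] [Module K P]
    {V : ι → Type*} [∀ i, AddCommGroup (V i)] [∀ i, Module K (V i)] (p : ι → P)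
    (f : ∀ i, P →ₗ[K] V i) (hne : ∀ i j, j ≠ i → f j (p i) = 0) (hself : ∀ i, f i (p i) ≠ 0) :
    LinearIndependent K p := by
  refine linearIndependent_iff'.mpr fun s c hc i hi => ?_
  have hci := congrArg (f i) hc
  rw [map_sum, map_zero, Finset.sum_eq_single_of_mem i hi fun j _ hji => by
    rw [map_smul, hne j i hji.symm, smul_zero], map_smul] at hci
  exact (smul_eq_zero.mp hci).resolve_right (hself i)

theorem card_le_finrank_of_simple_quotients {K g P ι : Type*} [Field K] [LieRing g]
    [AddCommGroup P] [Module K P] [LieRingModule g P] [FiniteDimensional K P]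
    [Fintype ι] {V : ι → Type*} [∀ i, AddCommGroup (V i)] [∀ i, Module K (V i)]
    [∀ i, LieRingModule g (V i)] (hV : ∀ i, IsIrreducible K g (V i)) (f : ∀ i, P →ₗ⁅K,g⁆ V i)
    (hf : ∀ i, f i ≠ 0) (hne : ∀ i j, Nonempty (V i ≃ₗ⁅K,g⁆ V j) → i = j) :
    Fintype.card ι ≤ finrank K P := by
  classical
  choose p hp hp' using fun i => exists_ne_zero_of_notMem hV f hf hne (Finset.univ.erase i) i
    (Finset.notMem_erase i _)
  exact (linearIndependent_of_separating p (fun i => (f i : P →ₗ[K] V i)) (fun i j hji =>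
    hp i j (Finset.mem_erase.mpr ⟨hji, Finset.mem_univ j⟩)) hp').fintype_card_le_finrank

end Counting

variable {A : Type u} [LieRing A] [LieAlgebra ℂ A]

section Classes

theorem isIrreducible_of_equiv {R L V V' : Type*} [CommRing R] [LieRing L] [AddCommGroup V]
    [Module R V] [LieRingModule L V] [AddCommGroup V'] [Module R V'] [LieRingModule L V']
    (e : V ≃ₗ⁅R,L⁆ V') (h : IsIrreducible R L V) : IsIrreducible R L V' :=
  ((LieSubmodule.orderIsoMapComap e).isSimpleOrder_iff).mp h

theorem isSimpleFinDim_out (M : isoClasses (A := A) IsSimpleFinDim) : IsSimpleFinDim M.1.out := by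
  obtain ⟨V, ⟨hV, hV'⟩, hM⟩ := M.2
  have hM' : Quotient.mk (LieMod.isoSetoid A) V = M.1 := hM
  obtain ⟨e⟩ : Nonempty (V ≃ₗ⁅ℂ,A⁆ M.1.out) := Quotient.exact (hM'.trans M.1.out_eq.symm)
  exact ⟨isIrreducible_of_equiv e hV, Module.Finite.equiv e.toLinearEquiv⟩

instance (M : isoClasses (A := A) IsSimpleFinDim) : FiniteDimensional ℂ M.1.out :=
  (isSimpleFinDim_out M).2

theorem exists_equiv_out {S : LieMod A} (hS : IsSimpleFinDim S) :
    ∃ M : isoClasses (A := A) IsSimpleFinDim, Nonempty (S ≃ₗ⁅ℂ,A⁆ M.1.out) :=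
  ⟨⟨Quotient.mk (LieMod.isoSetoid A) S, S, hS, rfl⟩,
    Quotient.exact (Quotient.out_eq (Quotient.mk (LieMod.isoSetoid A) S)).symm⟩

theorem isoClasses_ext {Q : LieMod A → Prop} {M M' : isoClasses Q}
    (h : Nonempty (M.1.out ≃ₗ⁅ℂ,A⁆ M'.1.out)) : M = M' := by
  refine Subtype.ext ?_
  rw [← M.1.out_eq, ← M'.1.out_eq]
  exact Quotient.sound h

end Classes

section SemisimpleHom

variable {D E V W : Type u} [AddCommGroup D] [Module ℂ D] [LieRingModule A D]
  [AddCommGroup E] [Module ℂ E] [LieRingModule A E]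
  [AddCommGroup V] [Module ℂ V] [LieRingModule A V] [LieModule ℂ A V]
  [AddCommGroup W] [Module ℂ W] [LieRingModule A W] [LieModule ℂ A W]

theorem mult_eq_finrank [LieModule ℂ A E] [FiniteDimensional ℂ (E →ₗ⁅ℂ,A⁆ W)] :
    mult A W E = (finrank ℂ (E →ₗ⁅ℂ,A⁆ W) : ℕ∞) := by
  rw [mult, ← finrank_eq_rank, Cardinal.toENat_nat]

instance finiteDimensional_lieModuleHom [LieModule ℂ A E] [FiniteDimensional ℂ E]
    [FiniteDimensional ℂ W] : FiniteDimensional ℂ (E →ₗ⁅ℂ,A⁆ W) :=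
  Module.Finite.equiv (maxTrivLinearMapEquivLieModuleHom (R := ℂ) (L := A) (M := E) (N := W))

variable (E V W) in
/-- Composition of homomorphisms as a bilinear map. -/
noncomputable def compHom : (E →ₗ⁅ℂ,A⁆ V) →ₗ[ℂ] (V →ₗ⁅ℂ,A⁆ W) →ₗ[ℂ] (E →ₗ⁅ℂ,A⁆ W) :=
  LinearMap.mk₂ ℂ (fun p f => f.comp p)
    (fun p p' f => LieModuleHom.ext fun e => map_add f (p e) (p' e))
    (fun c p f => LieModuleHom.ext fun e => map_smul f c (p e))
    (fun _ _ _ => rfl) (fun _ _ _ => rfl)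

variable (E W) in
/-- The span of the homomorphisms `E → W` that factor through a simple finite-dimensional module. -/
noncomputable def throughSimple : Submodule ℂ (E →ₗ⁅ℂ,A⁆ W) :=
  ⨆ M : isoClasses (A := A) IsSimpleFinDim,
    LinearMap.range (TensorProduct.lift (compHom E M.1.out W))

theorem comp_mem_throughSimple (hV : IsSimpleFinDim (A := A) ⟨V⟩) (p : E →ₗ⁅ℂ,A⁆ V)
    (f : V →ₗ⁅ℂ,A⁆ W) : f.comp p ∈ throughSimple E W := by
  obtain ⟨M, ⟨e⟩⟩ := exists_equiv_out hV
  refine Submodule.mem_iSup_of_mem M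
    ⟨(e : V →ₗ⁅ℂ,A⁆ M.1.out).comp p ⊗ₜ f.comp (e.symm : M.1.out →ₗ⁅ℂ,A⁆ V), ?_⟩
  exact LieModuleHom.ext fun x => congrArg f (e.symm_apply_apply (p x))

theorem comp_mem_throughSimple_of_mem (q : D →ₗ⁅ℂ,A⁆ E) {h : E →ₗ⁅ℂ,A⁆ W}
    (hh : h ∈ throughSimple E W) : h.comp q ∈ throughSimple D W := by
  induction hh using Submodule.iSup_induction' with
  | zero => exact zero_mem _
  | add h k _ _ hh hk => exact add_mem hh hk
  | mem M h hh =>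
    obtain ⟨t, rfl⟩ := hh
    induction t using TensorProduct.induction_on with
    | zero => rw [map_zero]; exact zero_mem _
    | add s t hs ht => rw [map_add]; exact add_mem hs ht
    | tmul p f => exact comp_mem_throughSimple (isSimpleFinDim_out M) (p.comp q) f

variable [FiniteDimensional ℂ A] [LieAlgebra.IsKilling ℂ A]

theorem throughSimple_eq_top (E : Type u) [AddCommGroup E] [Module ℂ E] [LieRingModule A E]
    [LieModule ℂ A E] [FiniteDimensional ℂ E] : throughSimple (A := A) E W = ⊤ := by
  induction hn : finrank ℂ E using Nat.strong_induction_on generalizing E with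
  | _ n ih =>
    refine eq_top_iff.mpr fun h _ => ?_
    rcases subsingleton_or_nontrivial E with hE | hE
    · rw [show h = 0 from LieModuleHom.ext fun e => by
        rw [Subsingleton.elim e 0, map_zero, map_zero]]
      exact zero_mem _
    obtain ⟨S, hS, -⟩ := (eq_bot_or_exists_atom_le (⊤ : LieSubmodule ℂ A E)).resolve_left top_ne_bot
    obtain ⟨p, hp⟩ := exists_equivariant_projection S
    have hS_simple : IsSimpleFinDim (A := A) ⟨S⟩ := ⟨isIrreducible_of_isAtom hS, inferInstance⟩
    let π := LieSubmodule.Quotient.mk' S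
    obtain ⟨k, hk⟩ := exists_comp_eq_of_ker_le π (LieSubmodule.Quotient.surjective_mk' S)
      (h - (h.comp S.incl).comp p) fun e he => by
        have heS : e ∈ S := (LieSubmodule.Quotient.mk_eq_zero' (N := S)).mp he
        have hpe : p e = ⟨e, heS⟩ := hp ⟨e, heS⟩
        simp [hpe]
    have hlt : finrank ℂ (E ⧸ S) < n := by
      have : Nontrivial S.toSubmodule := (LieSubmodule.nontrivial_iff_ne_bot ℂ A E).mpr hS.1
      rw [← hn, ← S.toSubmodule.finrank_quotient_add_finrank]
      exact Nat.lt_add_of_pos_right finrank_pos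
    have hkπ : k.comp π ∈ throughSimple E W :=
      comp_mem_throughSimple_of_mem π (by rw [ih _ hlt (E ⧸ S) rfl]; trivial)
    rw [← sub_add_cancel h ((h.comp S.incl).comp p), ← hk]
    exact add_mem hkπ (comp_mem_throughSimple hS_simple p _)

theorem finrank_hom_le_sum [LieModule ℂ A E] [FiniteDimensional ℂ E]
    [∀ M : isoClasses (A := A) IsSimpleFinDim, FiniteDimensional ℂ (M.1.out →ₗ⁅ℂ,A⁆ W)]
    (F : Finset (isoClasses (A := A) IsSimpleFinDim))
    (hF : ∀ M ∉ F, ∀ p : E →ₗ⁅ℂ,A⁆ M.1.out, p = 0) :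
    finrank ℂ (E →ₗ⁅ℂ,A⁆ W) ≤
      ∑ M ∈ F, finrank ℂ (E →ₗ⁅ℂ,A⁆ M.1.out) * finrank ℂ (M.1.out →ₗ⁅ℂ,A⁆ W) := by
  classical
  let Φ : (∀ M : F, (E →ₗ⁅ℂ,A⁆ M.1.1.out) ⊗[ℂ] (M.1.1.out →ₗ⁅ℂ,A⁆ W)) →ₗ[ℂ] (E →ₗ⁅ℂ,A⁆ W) :=
    LinearMap.lsum ℂ _ ℂ fun M => TensorProduct.lift (compHom E M.1.1.out W)
  have hrange : throughSimple E W ≤ LinearMap.range Φ := by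
    refine iSup_le fun M => ?_
    rintro _ ⟨t, rfl⟩
    by_cases hM : M ∈ F
    · exact ⟨Pi.single ⟨M, hM⟩ t, by rw [LinearMap.lsum_piSingle]⟩
    · have : Subsingleton (E →ₗ⁅ℂ,A⁆ M.1.out) := ⟨fun p q => (hF M hM p).trans (hF M hM q).symm⟩
      rw [Subsingleton.elim t 0, map_zero]
      exact zero_mem _
  have hsurj : Function.Surjective Φ :=
    LinearMap.range_eq_top.mp (top_le_iff.mp ((throughSimple_eq_top E).ge.trans hrange))
  refine (LinearMap.finrank_le_finrank_of_surjective hsurj).trans_eq ?_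
  rw [finrank_pi_fintype, ← Finset.sum_coe_sort F]
  exact Finset.sum_congr rfl fun M _ => finrank_tensorProduct

end SemisimpleHom

section TensorMultiplicity

theorem encard_le_of_forall_finset_card_le {α : Type*} {s : Set α} {n : ℕ}
    (h : ∀ t : Finset α, ↑t ⊆ s → t.card ≤ n) : s.encard ≤ n := by
  have hfin : s.Finite := by
    by_contra hinf
    obtain ⟨t, hts, hcard⟩ := Set.Infinite.exists_subset_card_eq hinf (n + 1)
    exact Nat.not_succ_le_self n (hcard.symm.trans_le (h t hts))
  rw [hfin.encard_eq_coe_toFinset_card, Nat.cast_le]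
  exact h _ hfin.coe_toFinset.subset

theorem finite_setOf_exists_hom_ne_zero (E : Type u) [AddCommGroup E] [Module ℂ E]
    [LieRingModule A E] [FiniteDimensional ℂ E] :
    {M : isoClasses (A := A) IsSimpleFinDim | ∃ p : E →ₗ⁅ℂ,A⁆ M.1.out, p ≠ 0}.Finite := by
  refine Set.finite_of_encard_le_coe (k := finrank ℂ E)
    (encard_le_of_forall_finset_card_le fun T hT => ?_)
  choose p hp using fun M : T => hT M.2
  rw [← Fintype.card_coe]
  exact card_le_finrank_of_simple_quotients (fun M => (isSimpleFinDim_out M.1).1) p hp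
    fun M M' h => Subtype.ext (isoClasses_ext h)

variable [FiniteDimensional ℂ A] [LieAlgebra.IsKilling ℂ A]

theorem finrank_hom_tensor_le (L W : Type u) [AddCommGroup L] [Module ℂ L] [LieRingModule A L]
    [LieModule ℂ A L] [FiniteDimensional ℂ L] [AddCommGroup W] [Module ℂ W] [LieRingModule A W]
    [LieModule ℂ A W]
    [∀ M : isoClasses (A := A) IsSimpleFinDim, FiniteDimensional ℂ (M.1.out →ₗ⁅ℂ,A⁆ W)] :
    (finrank ℂ (L →ₗ⁅ℂ,A⁆ W ⊗[ℂ] L) : ℕ∞) ≤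
      ∑' M : isoClasses (A := A) IsSimpleFinDim, mult A (M.1.out ⊗[ℂ] L) L * mult A W M.1.out ∧
    ∑' M : isoClasses (A := A) IsSimpleFinDim,
      mult A (M.1.out ⊗[ℂ] L) L * mult A W M.1.out < ⊤ := by
  let E := L ⊗[ℂ] Dual ℂ L
  let F := (finite_setOf_exists_hom_ne_zero (A := A) E).toFinset
  have hF (M) (hM : M ∉ F) (p : E →ₗ⁅ℂ,A⁆ M.1.out) : p = 0 := by
    by_contra hp
    exact hM ((Set.Finite.mem_toFinset _).mpr ⟨p, hp⟩)
  have hmult (M : isoClasses (A := A) IsSimpleFinDim) :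
      mult A (M.1.out ⊗[ℂ] L) L = finrank ℂ (E →ₗ⁅ℂ,A⁆ M.1.out) := by
    rw [mult_eq_finrank (E := L), (homTensorEquiv L L M.1.out).finrank_eq]
  have hsum : ∑' M : isoClasses (A := A) IsSimpleFinDim,
      mult A (M.1.out ⊗[ℂ] L) L * mult A W M.1.out =
      ((∑ M ∈ F, finrank ℂ (E →ₗ⁅ℂ,A⁆ M.1.out) * finrank ℂ (M.1.out →ₗ⁅ℂ,A⁆ W) : ℕ) : ℕ∞) := by
    push_cast
    rw [tsum_eq_sum (s := F) fun M hM => ?_]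
    · exact Finset.sum_congr rfl fun M _ => by rw [hmult M, mult_eq_finrank (E := M.1.out)]
    · have : Subsingleton (E →ₗ⁅ℂ,A⁆ M.1.out) := ⟨fun p q => (hF M hM p).trans (hF M hM q).symm⟩
      rw [hmult M, finrank_zero_of_subsingleton, Nat.cast_zero, zero_mul]
  rw [hsum, (homTensorEquiv L L W).finrank_eq, Nat.cast_le]
  exact ⟨finrank_hom_le_sum F hF, ENat.natCast_lt_top _⟩

end TensorMultiplicity

end Multiplicity

section Types

open LieModule Module

variable {𝔏 : Type u} [LieRing 𝔏] [LieAlgebra ℂ 𝔏] {g : LieSubalgebra ℂ 𝔏}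
  {N : Type u} [AddCommGroup N] [Module ℂ N] [LieRingModule 𝔏 N] [LieModule ℂ 𝔏 N]
  {L : Type u} [AddCommGroup L] [Module ℂ L] [LieRingModule g L] [LieModule ℂ g L]

theorem hasType_of_ne_zero (hL : IsIrreducible ℂ g L) (f : L →ₗ⁅ℂ,g⁆ N) (hf : f ≠ 0) :
    HasType g N L := by
  have hinj := injective_of_isIrreducible hL f hf
  let f' : L →ₗ⁅ℂ,g⁆ f.range := f.codRestrict f.range fun l =>
    (LieModuleHom.mem_range f _).mpr ⟨l, rfl⟩
  have hf' : Function.Bijective f' := by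
    refine ⟨fun l l' h => hinj (congrArg Subtype.val h), ?_⟩
    rintro ⟨n, hn⟩
    obtain ⟨l, rfl⟩ := (LieModuleHom.mem_range f _).mp hn
    exact ⟨l, rfl⟩
  exact ⟨f.range, ⟨(equivOfBijective f' hf').symm⟩⟩

theorem HasType.exists_injective_hom (h : HasType g N L) :
    ∃ φ : L →ₗ⁅ℂ,g⁆ N, Function.Injective φ := by
  obtain ⟨S, ⟨e⟩⟩ := h
  exact ⟨S.incl.comp (e.symm : L →ₗ⁅ℂ,g⁆ S), S.injective_incl.comp e.symm.injective⟩

theorem isHarishChandra_of_locFin [FiniteDimensional ℂ g] [LieAlgebra.IsKilling ℂ g]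
    (hN : LocFin ℂ g N) (hfin : ∀ S : LieSubmodule ℂ g N, FiniteDimensional ℂ S →
      FiniteDimensional ℂ (S →ₗ⁅ℂ,g⁆ N)) : IsHarishChandra g N := by
  classical
  obtain ⟨s, hs, hs'⟩ := hN.exists_isInternal
  refine ⟨s, _, fun i => i.1, hs, hs', fun i => ?_⟩
  have := (hs i).1
  have := hfin i.1 (hs i).2
  have := LieModule.nontrivial_of_isIrreducible ℂ g i.1
  obtain ⟨v, hv⟩ := exists_ne (0 : i.1)
  let J := {j : s | Nonempty (j.1 ≃ₗ⁅ℂ,g⁆ i.1)}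
  let e (j : J) : i.1 ≃ₗ⁅ℂ,g⁆ j.1.1 := j.2.some.symm
  let embedding (j : J) : i.1 →ₗ⁅ℂ,g⁆ N := j.1.1.incl.comp (e j : i.1 →ₗ⁅ℂ,g⁆ j.1.1)
  let evalAt : (i.1 →ₗ⁅ℂ,g⁆ N) →ₗ[ℂ] N :=
    { toFun := fun f => f v
      map_add' := fun _ _ => rfl
      map_smul' := fun _ _ => rfl }
  have hindep : LinearIndependent ℂ embedding := by
    refine LinearIndependent.of_comp evalAt ?_
    refine iSupIndep.linearIndependent (fun j : J => j.1.1.toSubmodule)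
      (hs'.submodule_iSupIndep.comp Subtype.val_injective) (fun j => (e j v).2) fun j h => hv ?_
    exact (map_eq_zero_iff (e j) (e j).injective).mp (Subtype.ext h)
  exact hindep.finite_of_isNoetherian

theorem IsLevi.idealFG_of_hasType [IsLieAbelian (LieAlgebra.radical ℂ 𝔏)] (hg : IsLevi g)
    (hN : IsIrreducible ℂ 𝔏 N) [FiniteDimensional ℂ L] (hL : IsIrreducible ℂ g L)
    (h : HasType g N L) : IdealFG (LieAlgebra.radical ℂ 𝔏) N := by
  obtain ⟨S, ⟨e⟩⟩ := h
  have hS : FiniteDimensional ℂ S := Module.Finite.equiv e.symm.toLinearEquiv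
  have := isIrreducible_of_equiv e.symm hL
  have := LieModule.nontrivial_of_isIrreducible ℂ g S
  obtain ⟨s, hs⟩ := exists_ne (0 : S)
  refine IdealFG.of_lieSpan_eq_top hg.isCompl.sup_eq_top
    (Module.Finite.iff_fg.mp (show Module.Finite ℂ S.toSubmodule from hS))
    (fun x _ w hw => S.lie_mem (x := ⟨x, ‹_›⟩) hw) ?_
  refine (hN.eq_bot_or_eq_top _).resolve_left fun h0 => hs (Subtype.ext ?_)
  exact (LieSubmodule.mem_bot _).mp (h0 ▸ LieSubmodule.subset_lieSpan s.2)

section SimpleQuotients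

variable [FiniteDimensional ℂ g] [LieAlgebra.IsKilling ℂ g] {ι : Type*}
  {V : ι → Type u} [∀ i, AddCommGroup (V i)] [∀ i, Module ℂ (V i)] [∀ i, LieRingModule 𝔏 (V i)]
  [∀ i, LieModule ℂ 𝔏 (V i)]

theorem exists_hom_of_hasType [Finite ι] (hN : LocFin ℂ g N)
    (hV : ∀ i, IsIrreducible ℂ 𝔏 (V i)) (f : ∀ i, N →ₗ⁅ℂ,𝔏⁆ V i) (hf : ∀ i, f i ≠ 0)
    (hne : ∀ i j, Nonempty (V i ≃ₗ⁅ℂ,𝔏⁆ V j) → i = j) (i : ι) (ht : HasType g (V i) L) :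
    ∃ ψ : L →ₗ⁅ℂ,g⁆ N, (∀ j ≠ i, ∀ l, f j (ψ l) = 0) ∧ ∀ l ≠ 0, f i (ψ l) ≠ 0 := by
  classical
  have := Fintype.ofFinite ι
  obtain ⟨φ, hφ⟩ := ht.exists_injective_hom
  let S : LieSubmodule ℂ 𝔏 N := ⨅ j : Finset.univ.erase i, (f j).ker
  have hS (p : N) : p ∈ S ↔ ∀ j ≠ i, f j p = 0 := by simp [S, LieSubmodule.mem_iInf]
  obtain ⟨p, hp, hp'⟩ := exists_ne_zero_of_notMem hV f hf hne (Finset.univ.erase i) i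
    (Finset.notMem_erase i _)
  have hpS : p ∈ S :=
    (hS p).mpr fun j hj => hp j (Finset.mem_erase.mpr ⟨hj, Finset.mem_univ j⟩)
  have hsurj : Function.Surjective ((f i).comp S.incl) :=
    surjective_of_isIrreducible (hV i) _ fun h0 => hp' (LieModuleHom.congr_fun h0 ⟨p, hpS⟩)
  have := (hN.of_injective (S.incl.restrictLie g) S.injective_incl).complementedLattice
  obtain ⟨σ, hσ⟩ := exists_rightInverse_of_surjective (((f i).comp S.incl).restrictLie g) hsurj
  refine ⟨(S.incl.restrictLie g).comp (σ.comp φ), fun j hj l => (hS _).mp (σ (φ l)).2 j hj,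
    fun l hl h0 => hl ((map_eq_zero_iff φ hφ).mp ?_)⟩
  exact (hσ (φ l)).symm.trans h0

theorem card_le_finrank_of_hasType [Fintype ι] [FiniteDimensional ℂ (L →ₗ⁅ℂ,g⁆ N)]
    (hL : IsIrreducible ℂ g L) (hN : LocFin ℂ g N) (hV : ∀ i, IsIrreducible ℂ 𝔏 (V i))
    (f : ∀ i, N →ₗ⁅ℂ,𝔏⁆ V i) (hf : ∀ i, f i ≠ 0)
    (hne : ∀ i j, Nonempty (V i ≃ₗ⁅ℂ,𝔏⁆ V j) → i = j) (ht : ∀ i, HasType g (V i) L) :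
    Fintype.card ι ≤ finrank ℂ (L →ₗ⁅ℂ,g⁆ N) := by
  have := LieModule.nontrivial_of_isIrreducible ℂ g L
  obtain ⟨l, hl⟩ := exists_ne (0 : L)
  choose ψ hψ hψ' using fun i => exists_hom_of_hasType hN hV f hf hne i (ht i)
  let evalAt (i : ι) : (L →ₗ⁅ℂ,g⁆ N) →ₗ[ℂ] V i :=
    { toFun := fun ψ => f i (ψ l)
      map_add' := fun ψ ψ' => map_add (f i) (ψ l) (ψ' l)
      map_smul' := fun c ψ => map_smul (f i) c (ψ l) }
  exact (linearIndependent_of_separating ψ evalAt (fun i j hji => hψ i j hji l)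
    fun i => hψ' i l hl).fintype_card_le_finrank

end SimpleQuotients

end Types

section TensorInfl

open LieModule UniversalEnvelopingAlgebra

variable {R L : Type*} [CommRing R] [LieRing L] [LieAlgebra R L] {g : LieSubalgebra R L}
  {I : LieIdeal R L} (h : IsCompl g.toSubmodule I.toSubmodule)
  (V : Type*) [AddCommGroup V] [Module R V] [LieRingModule L V] [LieModule R L V]
  (E : Type*) [AddCommGroup E] [Module R E] [LieRingModule g E] [LieModule R g E]

/-- The tensor product of the `L`-module `V` with the inflation of the `g`-module `E`. It is a type
synonym so that `g` acts on it only by restriction from `L`, and not also through the `g`-module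
structures of the two factors. -/
def TensorInfl : Type _ := V ⊗[R] Infl h E

noncomputable instance : AddCommGroup (TensorInfl h V E) :=
  inferInstanceAs (AddCommGroup (V ⊗[R] Infl h E))
noncomputable instance : Module R (TensorInfl h V E) :=
  inferInstanceAs (Module R (V ⊗[R] Infl h E))
noncomputable instance : LieRingModule L (TensorInfl h V E) :=
  inferInstanceAs (LieRingModule L (V ⊗[R] Infl h E))
instance : LieModule R L (TensorInfl h V E) :=
  inferInstanceAs (LieModule R L (V ⊗[R] Infl h E))

/-- The identity, as an isomorphism from the tensor product of `L`-modules to `TensorInfl`. -/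
noncomputable def toTensorInfl : V ⊗[R] Infl h E ≃ₗ⁅R,L⁆ TensorInfl h V E :=
  (LieModuleEquiv.refl : V ⊗[R] Infl h E ≃ₗ⁅R,L⁆ V ⊗[R] Infl h E)

theorem congr_inflEquiv_lie (x : g) (t : V ⊗[R] E) :
    TensorProduct.congr (LinearEquiv.refl R V) (inflEquiv h E).toLinearEquiv ⁅x, t⁆ =
      ⁅(x : L), TensorProduct.congr (LinearEquiv.refl R V) (inflEquiv h E).toLinearEquiv t⁆ := by
  induction t using TensorProduct.induction_on with
  | zero => simp only [lie_zero, map_zero]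
  | tmul v e =>
    have he : inflEquiv h E ⁅x, e⁆ = ⁅(x : L), inflEquiv h E e⁆ :=
      (inflEquiv h E).toLieModuleHom.map_lie x e
    rw [TensorProduct.LieModule.lie_tmul_right, map_add, TensorProduct.congr_tmul,
      TensorProduct.congr_tmul, TensorProduct.congr_tmul, TensorProduct.LieModule.lie_tmul_right]
    exact congrArg _ (congrArg _ he)
  | add s t hs ht => simp only [lie_add, map_add, hs, ht]

/-- The isomorphism of the tensor product of `g`-modules with the restriction of `TensorInfl`. -/
noncomputable def tensorInflEquiv : V ⊗[R] E ≃ₗ⁅R,g⁆ TensorInfl h V E :=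
  { TensorProduct.congr (LinearEquiv.refl R V) (inflEquiv h E).toLinearEquiv ≪≫ₗ
      (toTensorInfl h V E).toLinearEquiv with
    map_lie' := fun {x t} => (congrArg (toTensorInfl h V E) (congr_inflEquiv_lie h V E x t)).trans
      ((toTensorInfl h V E).toLieModuleHom.map_lie (x : L) _) }

variable {V E}

theorem tensorInflEquiv_tmul (v : V) (e : E) :
    tensorInflEquiv h V E (v ⊗ₜ e) = toTensorInfl h V E (v ⊗ₜ inflEquiv h E e) :=
  rfl

theorem tensorInfl_induction {C : TensorInfl h V E → Prop} (zero : C 0)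
    (tmul : ∀ v e, C (tensorInflEquiv h V E (v ⊗ₜ e))) (add : ∀ s t, C s → C t → C (s + t))
    (t : TensorInfl h V E) : C t := by
  obtain ⟨t, rfl⟩ := (tensorInflEquiv h V E).surjective t
  induction t using TensorProduct.induction_on with
  | zero => rwa [map_zero]
  | tmul v e => exact tmul v e
  | add s t hs ht => rw [map_add]; exact add _ _ hs ht

theorem act_tensorInfl {a : UniversalEnvelopingAlgebra R L} (ha : a ∈ idealEnv I) (v : V) (e : E) :
    act (TensorInfl h V E) a (tensorInflEquiv h V E (v ⊗ₜ e)) =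
      tensorInflEquiv h V E (act V a v ⊗ₜ e) := by
  rw [tensorInflEquiv_tmul, tensorInflEquiv_tmul,
    ← act_tmul (fun x hx e => lie_infl_eq_zero h E hx e) ha]
  exact (map_act (toTensorInfl h V E : V ⊗[R] Infl h E →ₗ⁅R,L⁆ TensorInfl h V E) a _).symm

variable {v : V} (hv : v ∈ maxTrivSubmodule R g V)

variable (E) in
/-- The embedding `e ↦ v ⊗ e` given by a `g`-invariant vector `v`. -/
noncomputable def inflIncl : E →ₗ⁅R,g⁆ TensorInfl h V E :=
  { (tensorInflEquiv h V E).toLinearMap ∘ₗ TensorProduct.mk R V E v with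
    map_lie' := fun {x e} => by
      have hlie := (tensorInflEquiv h V E).toLieModuleHom.map_lie x (v ⊗ₜ e)
      rw [TensorProduct.LieModule.lie_tmul_right,
        (mem_maxTrivSubmodule R g _ _).mp hv x, TensorProduct.zero_tmul, zero_add] at hlie
      exact hlie }

theorem inflIncl_apply (e : E) : inflIncl h E hv e = tensorInflEquiv h V E (v ⊗ₜ e) :=
  rfl

variable (hgen : ∀ w : V, ∃ a : idealEnv I, act V (a : UniversalEnvelopingAlgebra R L) v = w)
include hv hgen

theorem lieSpan_range_inflIncl :
    LieSubmodule.lieSpan R L (Set.range (inflIncl h E hv)) = ⊤ := by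
  refine eq_top_iff.mpr fun t _ => ?_
  induction t using tensorInfl_induction with
  | zero => exact zero_mem _
  | tmul w e =>
    obtain ⟨a, rfl⟩ := hgen w
    rw [← act_tensorInfl h a.2, ← inflIncl_apply h hv]
    exact act_mem _ _ _ (LieSubmodule.subset_lieSpan ⟨e, rfl⟩)
  | add s t hs ht => exact add_mem (hs trivial) (ht trivial)

theorem idealFG_tensorInfl [Module.Finite R E] : IdealFG I (TensorInfl h V E) := by
  let f : E →ₗ⁅R,g⁆ TensorInfl h V E := inflIncl h E hv
  refine IdealFG.of_lieSpan_eq_top h.sup_eq_top (W := f.range.toSubmodule)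
    (Module.Finite.iff_fg.mp (Module.Finite.range (f : E →ₗ[R] TensorInfl h V E)))
    (fun x hx w hw => f.range.lie_mem (x := ⟨x, hx⟩) hw) ?_
  rw [LieSubmodule.coe_toSubmodule, LieModuleHom.coe_range]
  exact lieSpan_range_inflIncl h hv hgen

end TensorInfl

section Cover

open LieModule Module

variable {𝔏 : Type u} [LieRing 𝔏] [LieAlgebra ℂ 𝔏] {g : LieSubalgebra ℂ 𝔏} (hg : IsLevi g)
  {χ : radicalCenter 𝔏 →ₐ[ℂ] ℂ} {L : Type u} [AddCommGroup L] [Module ℂ L] [LieRingModule g L]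
  [LieModule ℂ g L]

variable (χ L) in
/-- The `𝔏`-module `V(0, χ) ⊗ L`, where the radical acts on `L` by zero. -/
abbrev Cover : Type u := TensorInfl hg.isCompl (V₀ g χ) L

theorem hasRadicalCharacter_cover : HasRadicalCharacter χ (Cover hg χ L) := by
  intro z t
  induction t using tensorInfl_induction with
  | zero => rw [map_zero, smul_zero]
  | tmul v l =>
    refine (act_tensorInfl hg.isCompl z.2.2 v l).trans ?_
    rw [show act (V₀ g χ) (z : Env 𝔏) v = χ z • v from hasRadicalCharacter_V₀ g χ z v,
      ← TensorProduct.smul_tmul', map_smul]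
  | add s t hs ht => rw [map_add, hs, ht, smul_add]

variable (χ L) in
/-- The embedding of `L` into `V(0, χ) ⊗ L` given by the canonical generator of `V(0, χ)`. -/
noncomputable def coverIncl : L →ₗ⁅ℂ,g⁆ Cover hg χ L := inflIncl hg.isCompl L toV_one_mem_maxTriv

variable [IsLieAbelian (LieAlgebra.radical ℂ 𝔏)]

theorem lieSpan_range_coverIncl :
    LieSubmodule.lieSpan ℂ 𝔏 (Set.range (coverIncl hg χ L)) = ⊤ :=
  lieSpan_range_inflIncl hg.isCompl toV_one_mem_maxTriv (exists_act_toV_one_eq hg)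

variable [FiniteDimensional ℂ L]

theorem idealFG_cover : IdealFG (LieAlgebra.radical ℂ 𝔏) (Cover hg χ L) :=
  idealFG_tensorInfl hg.isCompl toV_one_mem_maxTriv (exists_act_toV_one_eq hg)

variable [FiniteDimensional ℂ 𝔏]

theorem locFin_cover : LocFin ℂ g (Cover hg χ L) :=
  ((locFin_V₀ hg).tensor LocFin.of_finiteDimensional).of_surjective
    (tensorInflEquiv hg.isCompl (V₀ g χ) L).toLieModuleHom
    (tensorInflEquiv hg.isCompl (V₀ g χ) L).surjective

theorem exists_hom_cover [LieAlgebra.IsKilling ℂ g] {V : Type u} [AddCommGroup V] [Module ℂ V]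
    [LieRingModule 𝔏 V] [LieModule ℂ 𝔏 V] (hL : IsIrreducible ℂ g L) (hV : IsIrreducible ℂ 𝔏 V)
    (hχ : HasRadicalCharacter χ V) (ht : HasType g V L) : ∃ f : Cover hg χ L →ₗ⁅ℂ,𝔏⁆ V, f ≠ 0 := by
  have := LieModule.nontrivial_of_isIrreducible ℂ g L
  obtain ⟨l, hl⟩ := exists_ne (0 : L)
  obtain ⟨φ, hφ⟩ := ht.exists_injective_hom
  let ψ : Infl hg.isCompl L →ₗ⁅ℂ,g⁆ V := φ.comp (inflEquiv hg.isCompl L).symm.toLieModuleHom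
  have hψ : (ψ : Infl hg.isCompl L →ₗ[ℂ] V) ∈ maxTrivSubmodule ℂ g (Infl hg.isCompl L →ₗ[ℂ] V) :=
    (maxTrivLinearMapEquivLieModuleHom.symm ψ).2
  obtain ⟨F, hF⟩ := exists_hom_V₀ (g := g) (χ := χ) (ψ : Infl hg.isCompl L →ₗ[ℂ] V) fun u hu =>
    ker_toV_le_leftAnnihilator hg (fun x hx e => lie_infl_eq_zero hg.isCompl L hx e) hV
      (hg.idealFG_of_hasType hV hL ht) hχ hψ hu
  let F' := TensorProduct.LieModule.liftLie ℂ 𝔏 (V₀ g χ) (Infl hg.isCompl L) V F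
  let e := toTensorInfl hg.isCompl (V₀ g χ) L
  refine ⟨F'.comp e.symm.toLieModuleHom, fun h0 => hl ((map_eq_zero_iff φ hφ).mp ?_)⟩
  have hF' : F' (toV g χ 1 ⊗ₜ inflEquiv hg.isCompl L l) = φ l := by
    rw [TensorProduct.LieModule.liftLie_apply, hF, map_one]
    rfl
  exact hF'.symm.trans (LieModuleHom.congr_fun h0 (e (toV g χ 1 ⊗ₜ inflEquiv hg.isCompl L l)))

end Cover

section Quotient

open LieModule

theorem isIrreducible_of_isCoatom_ker {R L N N' : Type*} [CommRing R] [LieRing L] [LieAlgebra R L]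
    [AddCommGroup N] [Module R N] [LieRingModule L N] [LieModule R L N] [AddCommGroup N']
    [Module R N'] [LieRingModule L N'] [LieModule R L N'] (f : N →ₗ⁅R,L⁆ N')
    (hf : Function.Surjective f) (hker : IsCoatom f.ker) : IsIrreducible R L N' := by
  have hmap (T : LieSubmodule R L N') : (T.comap f).map f = T :=
    SetLike.coe_injective (Set.image_preimage_eq _ hf)
  have hnt : Nontrivial N' := by
    by_contra! hsub
    exact hker.1 (eq_top_iff.mpr fun n _ => Subsingleton.elim (f n) 0)
  refine LieModule.IsIrreducible.mk fun T hT => ?_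
  have hle : f.ker ≤ T.comap f := (LieSubmodule.gc_map_comap f).monotone_u bot_le
  rcases hker.le_iff.mp hle with htop | hbot
  · rw [← hmap T, htop, LieModuleHom.map_top]
    exact f.range_eq_top.mpr hf
  · refine absurd ?_ hT
    rw [eq_bot_iff, ← hmap T, hbot, LieSubmodule.map_le_iff_le_comap]
    exact le_rfl

end Quotient

section Classification

open LieModule Module

variable {𝔏 : Type u} [LieRing 𝔏] [LieAlgebra ℂ 𝔏]

theorem HasRadicalCharacter.of_surjective {χ : radicalCenter 𝔏 →ₐ[ℂ] ℂ} {N N' : Type u}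
    [AddCommGroup N] [Module ℂ N] [LieRingModule 𝔏 N] [LieModule ℂ 𝔏 N] [AddCommGroup N']
    [Module ℂ N'] [LieRingModule 𝔏 N'] [LieModule ℂ 𝔏 N'] (hχ : HasRadicalCharacter χ N)
    (f : N →ₗ⁅ℂ,𝔏⁆ N') (hf : Function.Surjective f) : HasRadicalCharacter χ N' := by
  intro z n'
  obtain ⟨n, rfl⟩ := hf n'
  rw [← map_smul, ← hχ z n]
  exact (map_act f (z : Env 𝔏) n).symm

variable [FiniteDimensional ℂ 𝔏] [IsLieAbelian (LieAlgebra.radical ℂ 𝔏)] {g : LieSubalgebra ℂ 𝔏}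
  [LieAlgebra.IsKilling ℂ g] (hg : IsLevi g) (χ : radicalCenter 𝔏 →ₐ[ℂ] ℂ)
  (L : Type u) [AddCommGroup L] [Module ℂ L] [LieRingModule g L] [LieModule ℂ g L]
  [FiniteDimensional ℂ L]

include hg in
theorem finrank_hom_le_bound :
    (finrank ℂ (L →ₗ⁅ℂ,g⁆ V₀ g χ ⊗[ℂ] L) : ℕ∞) ≤ bound g χ L ∧ bound g χ L < ⊤ :=
  have (M : isoClasses (A := g) IsSimpleFinDim) : FiniteDimensional ℂ (M.1.out →ₗ⁅ℂ,g⁆ V₀ g χ) :=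
    finiteDimensional_hom hg (locFin_V₀ hg) (hasRadicalCharacter_V₀ g χ) (idealFG_V₀ hg) M.1.out
  finrank_hom_tensor_le L (V₀ g χ)

variable (hL : IsIrreducible ℂ g L)

include hg hL

theorem exists_isSimpleHC : ∃ V : LieMod 𝔏, IsSimpleHC g χ L V := by
  have := LieModule.nontrivial_of_isIrreducible ℂ g L
  have := nontrivial_V₀ (χ := χ) hg
  have : Nontrivial (Cover hg χ L) :=
    (tensorInflEquiv hg.isCompl (V₀ g χ) L).symm.surjective.nontrivial
  have := (idealFG_cover (χ := χ) (L := L) hg).isCoatomic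
  obtain ⟨S, hS⟩ := IsCoatomic.exists_coatom (LieSubmodule ℂ 𝔏 (Cover hg χ L))
  let π := LieSubmodule.Quotient.mk' S
  have hπ : Function.Surjective π := LieSubmodule.Quotient.surjective_mk' S
  have hirr : IsIrreducible ℂ 𝔏 (Cover hg χ L ⧸ S) :=
    isIrreducible_of_isCoatom_ker π hπ (by rwa [LieSubmodule.Quotient.mk'_ker])
  have hχ : HasRadicalCharacter χ (Cover hg χ L ⧸ S) :=
    (hasRadicalCharacter_cover hg).of_surjective π hπ
  have hloc : LocFin ℂ g (Cover hg χ L ⧸ S) := (locFin_cover hg).of_surjective (π.restrictLie g) hπ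
  have htype : HasType g (Cover hg χ L ⧸ S) L := by
    refine hasType_of_ne_zero hL ((π.restrictLie g).comp (coverIncl hg χ L)) fun h0 => hS.1 ?_
    rw [eq_top_iff, ← lieSpan_range_coverIncl hg, LieSubmodule.lieSpan_le]
    rintro _ ⟨l, rfl⟩
    exact (LieSubmodule.Quotient.mk_eq_zero S).mp (LieModuleHom.congr_fun h0 l)
  have hfg := hg.idealFG_of_hasType hirr hL htype
  exact ⟨⟨Cover hg χ L ⧸ S⟩, hirr, isHarishChandra_of_locFin hloc
    (fun T _ => finiteDimensional_hom hg hloc hχ hfg T), hχ, htype⟩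

theorem encard_isoClasses_le :
    (isoClasses (IsSimpleHC g χ L)).encard ≤ (finrank ℂ (L →ₗ⁅ℂ,g⁆ V₀ g χ ⊗[ℂ] L) : ℕ∞) := by
  rw [(homCongrRight L (tensorInflEquiv hg.isCompl (V₀ g χ) L)).finrank_eq]
  have := finiteDimensional_hom hg (locFin_cover hg) (hasRadicalCharacter_cover hg)
    (idealFG_cover (χ := χ) (L := L) hg) L
  refine encard_le_of_forall_finset_card_le fun T hT => ?_
  choose V hV hVT using fun c : T => hT c.2
  choose f hf using fun c : T => exists_hom_cover hg hL (hV c).1 (hV c).2.2.1 (hV c).2.2.2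
  rw [← Fintype.card_coe]
  refine card_le_finrank_of_hasType hL (locFin_cover hg) (V := fun c : T => (V c).carrier)
    (fun c => (hV c).1) f hf (fun c c' hiso => Subtype.ext ?_) fun c => (hV c).2.2.2
  rw [← hVT c, ← hVT c']
  exact Quotient.sound hiso

end Classification

end GenTakiff

theorem proposition6p6 {𝔏 : Type u} [LieRing 𝔏] [LieAlgebra ℂ 𝔏] [FiniteDimensional ℂ 𝔏]
    (g : LieSubalgebra ℂ 𝔏) (hg : GenTakiff.IsLevi g)
    (hr : IsLieAbelian (LieAlgebra.radical ℂ 𝔏))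
    (χ : GenTakiff.radicalCenter 𝔏 →ₐ[ℂ] ℂ)
    (L : Type u) [AddCommGroup L] [Module ℂ L] [LieRingModule g L] [LieModule ℂ g L]
    (hL : LieModule.IsIrreducible ℂ g L) (hL' : FiniteDimensional ℂ L) :
    (∃ V : GenTakiff.LieMod 𝔏, GenTakiff.IsSimpleHC g χ L V) ∧
    (GenTakiff.isoClasses (GenTakiff.IsSimpleHC g χ L)).encard ≤ GenTakiff.bound g χ L ∧
    GenTakiff.bound g χ L < ⊤ := by
  have := hg.isKilling
  have h := GenTakiff.finrank_hom_le_bound hg χ L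
  exact ⟨GenTakiff.exists_isSimpleHC hg χ L hL,
    (GenTakiff.encard_isoClasses_le hg χ L hL).trans h.1, h.2⟩
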